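/- **Definitions.** Let $X$ be a set. "Countable" means finite or countably infinite. A family $\mathfrak S$ of subsets of $X$ is an *interval system* if for all $A,B\in\mathfrak S$ both $A\setminus B$ and $A\cap B$ are countable disjoint unions of members of $\mathfrak S$. Let $\mathcal W$ be a complete Hausdorff locally convex real topological vector space. A *measure* $\mu:\mathfrak S\to\mathcal W$ is a map such that $\mu(B)=\sum_\lambda\mu(A_\lambda)$ (unconditionally convergent) for every countable disjoint decomposition $B=\bigcup_\lambda A_\lambda$ with $B,A_\lambda\in\mathfrak S$. A *step function* is a finite sum $\sum_j c_j\chi_{E_j}$ with $c_j\in\mathbb R$, $E_j\in\mathfrak S$. An *envelope* is a set $\mathcal A\subset\mathbb R\times X$ which contains the graph of some step function and for which there is a countable $\mathfrak D\subset\mathfrak S$ with $$\mathcal A=\bigcup_{D\in\mathfrak D}(\mathcal A^D\times D)\ \cup\ \{0\}\times\Bigl(X\setminus\bigcup\mathfrak D\Bigr),\qquad \mathcal A^D=\{v\in\mathbb R:(v,x)\in\mathcal A\text{ for all }x\in D\}.$$ It is *pointed* if it contains the graph of $0$. Put $$\int^{\mathrm p}\mathcal A\,\mu=\overline{\Bigl\{\sum_{j\in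 J}c_j\mu(E_j): J\text{ finite},\ c_j\in\mathbb R,\ E_j\in\mathfrak S,\ \text{the graph of }\sum_{j\in J} c_j\chi_{E_j}\text{ is contained in }\mathcal A\Bigr\}}.$$ A function $f:X\to\mathbb R$ is *integrable* with integral $\int f\,\mu=a\in\mathcal W$ if for each neighborhood $T$ of $0$ in $\mathcal W$ there is an envelope $\mathcal A$ containing the graph of $f$ with $\int^{\mathrm p}\mathcal A\,\mu\subset a+T$. For integrable $f$ the *semivariation* is $$\operatorname{svar}(f,\mu)=\overline{\Bigl\{\sum_{j\in J}\int f\chi_{A_j}\,\mu: J\text{ finite},\ A_j\in\mathfrak S\text{ pairwise disjoint}\Bigr\}}.$$ A set $N\subset X$ is *strongly negligible* if for each neighborhood $T$ of $0$ there is a pointed envelope $\mathcal C\supset\mathbb R\times N$ with $\int^{\mathrm p}\mathcal C\,\mu\subset T$. For sets $S_\lambda\ni 0$, $\sum_{\lambda}S_\lambda$ is the set of all sums $\sum_\lambda a_\lambda$ with $a_\lambda\in S_\lambda$ and $a_\lambda=0$ for all but finitely many $\lambda$. **Theorem (Beppo Levi).** Let $\mathfrak S$ be an interval system on $X$ and $\mathcal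 W$ a complete Hausdorff locally convex real topological vector space. (a) Let $\mu:\mathfrak S\to\mathcal W$ be a measure and let $f_\lambda:X\to\mathbb R$ ($\lambda\in\Lambda$, $\Lambda$ countable) be integrable. Suppose that for each neighborhood $T$ of $0$ in $\mathcal W$ there is a finite set $\Xi\subset\Lambda$ such that $$\sum_{\lambda\in\Lambda\setminus\Xi}\operatorname{svar}(f_\lambda,\mu)\subset T.$$ Then $\sum_{\lambda\in\Lambda}f_\lambda(x)$ converges unconditionally for all $x$ outside a strongly negligible set. If $f:X\to\mathbb R$ satisfies $f(x)=\sum_{\lambda\in\Lambda} f_\lambda(x)$ at every point of convergence (and is arbitrary elsewhere), then $f$ is integrable, $\sum_{\lambda\in\Lambda}\int f_\lambda\,\mu$ converges unconditionally, $$\int f\,\mu=\sum_{\lambda\in\Lambda}\int f_\lambda\,\mu,\qquad\text{and}\qquad \operatorname{svar}(f,\mu)\subset\overline{\sum_{\lambda\in\Lambda}\operatorname{svar}(f_\lambda,\mu)}.$$ (b) Let $\mu:\mathfrak S\to\mathbb R$ be a measure and let $f_n:X\to\mathbb R$ ($n\in\mathbb N$) be integrable. If the set $\sum_{n\in\mathbb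 N}\operatorname{svar}(f_n,\mu)\subset\mathbb R$ is bounded, then the conclusions of (a) hold for the family $(f_n)_{n\in\mathbb N}$. -/

import Mathlib

open Set Topology

namespace LebesgueMcShane

/-- A family of sets is an interval system if all differences and intersections of two members
are countable disjoint unions of members. -/
def IsIntervalSystem {X : Type*} (𝔖 : Set (Set X)) : Prop :=
  ∀ A ∈ 𝔖, ∀ B ∈ 𝔖,
    (∃ C : Set (Set X), C.Countable ∧ C ⊆ 𝔖 ∧ C.PairwiseDisjoint id ∧ A \ B = ⋃₀ C) ∧
    (∃ D : Set (Set X), D.Countable ∧ D ⊆ 𝔖 ∧ D.PairwiseDisjoint id ∧ A ∩ B = ⋃₀ D)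

/-- `μ : 𝔖 → W` is a measure if it is `σ`-additive: for every countable (finite or infinite)
disjoint decomposition of `B ∈ 𝔖` into members `A l` of `𝔖`, the unconditional sum of the
`μ (A l)` exists and equals `μ B`. -/
def IsMeasure {X W : Type*} [AddCommGroup W] [TopologicalSpace W] {𝔖 : Set (Set X)}
    (μ : 𝔖 → W) : Prop :=
  ∀ (Λ : Type) [Countable Λ] (A : Λ → 𝔖) (B : 𝔖),
    Pairwise (fun i j => Disjoint (A i : Set X) (A j : Set X)) →
    (B : Set X) = ⋃ l, (A l : Set X) →
    HasSum (fun l => μ (A l)) (μ B)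

/-- The step function `∑ j, c j • χ_{E j}`. -/
noncomputable def stepFun {X : Type*} {𝔖 : Set (Set X)} {n : ℕ} (c : Fin n → ℝ)
    (E : Fin n → 𝔖) : X → ℝ :=
  fun x => ∑ j, (E j : Set X).indicator (fun _ => c j) x

/-- `𝒜 ⊆ ℝ × X` approximates `f` if it contains the graph of `f`. -/
def Approximates {X : Type*} (𝒜 : Set (ℝ × X)) (f : X → ℝ) : Prop :=
  ∀ x, (f x, x) ∈ 𝒜

/-- `𝒜^D`, the set of those `v` for which `(v, x) ∈ 𝒜` for all `x ∈ D`. -/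
def fiber {X : Type*} (𝒜 : Set (ℝ × X)) (D : Set X) : Set ℝ :=
  {v | ∀ x ∈ D, (v, x) ∈ 𝒜}

/-- `⟨𝔇⟩_𝒜`, the union of all `𝒜^D × D` with `D ∈ 𝔇` and of `{0} × (X \ ⋃ 𝔇)`. -/
def generated {X : Type*} (𝔇 : Set (Set X)) (𝒜 : Set (ℝ × X)) : Set (ℝ × X) :=
  (⋃ D ∈ 𝔇, fiber 𝒜 D ×ˢ D) ∪ ({0} ×ˢ (⋃₀ 𝔇)ᶜ)

/-- Envelopes (of sets in `ℝ` with respect to `𝔖`): the subsets of `ℝ × X` which contain the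
graph of a step function and have a countable generating set in `𝔖`. -/
def IsEnvelope {X : Type*} (𝔖 : Set (Set X)) (𝒜 : Set (ℝ × X)) : Prop :=
  (∃ (n : ℕ) (c : Fin n → ℝ) (E : Fin n → 𝔖), Approximates 𝒜 (stepFun c E)) ∧
  (∃ 𝔇 : Set (Set X), 𝔇.Countable ∧ 𝔇 ⊆ 𝔖 ∧ 𝒜 = generated 𝔇 𝒜)

/-- Pointed envelopes: those containing the graph of the zero function. -/
def IsPointedEnvelope {X : Type*} (𝔖 : Set (Set X)) (𝒞 : Set (ℝ × X)) : Prop :=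
  IsEnvelope 𝔖 𝒞 ∧ Approximates 𝒞 0

section Integral

variable {X W : Type*} [AddCommGroup W] [Module ℝ W] [TopologicalSpace W] {𝔖 : Set (Set X)}

/-- The bilinear sum `∫ᵖ 𝒜 μ`: the closure of the set of the pre-integrals `∑ j, c j • μ (E j)`
of all step functions `∑ j, c j • χ_{E j}` with graph in `𝒜`. -/
def preIntegral (μ : 𝔖 → W) (𝒜 : Set (ℝ × X)) : Set W :=
  closure {z | ∃ (n : ℕ) (c : Fin n → ℝ) (E : Fin n → 𝔖),
    Approximates 𝒜 (stepFun c E) ∧ z = ∑ j, c j • μ (E j)}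

/-- `a` is the (Lebesgue-McShane) integral of `f`. -/
def HasIntegral (μ : 𝔖 → W) (f : X → ℝ) (a : W) : Prop :=
  ∀ T ∈ 𝓝 (0 : W), ∃ 𝒜 : Set (ℝ × X), IsEnvelope 𝔖 𝒜 ∧ Approximates 𝒜 f ∧
    ∀ z ∈ preIntegral μ 𝒜, z - a ∈ T

/-- `f` is integrable with respect to `μ`. -/
def Integrable (μ : 𝔖 → W) (f : X → ℝ) : Prop :=
  ∃ a, HasIntegral μ f a

open Classical in
/-- The integral of an integrable function (and `0` for other functions). -/
noncomputable def integral (μ : 𝔖 → W) (f : X → ℝ) : W :=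
  if h : Integrable μ f then h.choose else 0

/-- The semivariation of `f` (for `f` integrable on all members of `𝔖`): the closure of the set
of all finite sums of integrals of `f` over pairwise disjoint members of `𝔖`. -/
def svar (μ : 𝔖 → W) (f : X → ℝ) : Set W :=
  closure {z | ∃ (n : ℕ) (A : Fin n → 𝔖),
    Pairwise (fun i j => Disjoint (A i : Set X) (A j : Set X)) ∧
    z = ∑ j, integral μ ((A j : Set X).indicator f)}

/-- `N` is strongly negligible: for each neighborhood `T` of `0` some pointed envelope `𝒞`
contains `ℝ × N` and satisfies `∫ᵖ 𝒞 μ ⊆ T`. -/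
def StronglyNegligible (μ : 𝔖 → W) (N : Set X) : Prop :=
  ∀ T ∈ 𝓝 (0 : W), ∃ 𝒞 : Set (ℝ × X), IsPointedEnvelope 𝔖 𝒞 ∧
    (univ : Set ℝ) ×ˢ N ⊆ 𝒞 ∧ preIntegral μ 𝒞 ⊆ T

end Integral

/-- The algebraic sum of a family of sets: all sums of finitely supported families
`a` with `a l ∈ S l` for every `l`. -/
def algSum {Λ W : Type*} [AddCommGroup W] (S : Λ → Set W) : Set W :=
  {z | ∃ a : Λ →₀ W, (∀ l, a l ∈ S l) ∧ z = a.sum fun _ w => w}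

end LebesgueMcShane

/-! Everything rests on one envelope which controls a whole tail of the series. Given a continuous
seminorm `p`, discard finitely many indices so that finite sums of elements of the remaining
semivariations satisfy `p z ≤ ε`. Give each remaining `F l` an envelope `𝒜 l` in which step
integrals differ from `∫ F l` by at most `e l`, where all finite sums of the `e l` are at most `ε`.
Let `domination 𝒜` consist of the `(v, x)` with `|v| ≤ 2 ∑ |w l|` for finitely many `w l` in the
fibers of `𝒜 l` at `x`.

A step function in this set is, on the pieces `G i` of a countable decomposition, of the form `2 ∑ θ
w` with `|θ| ≤ 1`. By convexity, coefficients in `[-1, 1]` cost only a factor 2 against plain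
partial sums. In a partial sum, the terms with a fixed `l` lie within `e l` of an element of `svar μ
(F l)` by the Saks-Henstock lemma `RingEnvelope.sum_sub_sum_mem`. Hence all step integrals satisfy
`p z ≤ 8ε` (`stepIntegralsIn_domination`).

The envelope contains every `(v, x)` with `x` a point of divergence, the graphs of finite tail sums,
and the graph of `f` minus a sufficiently long partial sum. These give, respectively, strong
negligibility, the Cauchy criterion for the integrals, and integrability of `f` with the right
value. Cutting the remainder down to disjoint members of `𝔖` gives the inclusion of semivariations.
For real measures, boundedness makes the suprema and infima of the semivariations summable, which
yields small tails.

An interval system is not closed under differences or intersections, so the work is done on a ring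
of countable disjoint unions carrying a `σ`-additive extension of `μ`. The bridge `hasIntegral_iff`
shows that step functions and envelopes over this ring define the same integral. -/

namespace LebesgueMcShane

/-! ### Countable disjoint decompositions into members of the interval system. -/

section Decompositions

variable {X : Type*} {𝔖 : Set (Set X)}

/-- `G` is a disjoint decomposition of `A` into members of `𝔖`. -/
def IsDecomposition {ι : Type*} (G : ι → 𝔖) (A : Set X) : Prop :=
  Pairwise (fun i j => Disjoint (G i : Set X) (G j : Set X)) ∧ A = ⋃ i, (G i : Set X)

/-- `A` is a countable disjoint union of members of `𝔖`. -/
def Decomposable (𝔖 : Set (Set X)) (A : Set X) : Prop :=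
  ∃ (ι : Type) (_ : Countable ι) (G : ι → 𝔖), IsDecomposition G A

theorem IsDecomposition.subset {ι : Type*} {G : ι → 𝔖} {A : Set X} (h : IsDecomposition G A)
    (i : ι) : (G i : Set X) ⊆ A := by
  rw [h.2]; exact subset_iUnion (fun i => (G i : Set X)) i

theorem IsDecomposition.sigma {ι : Type*} {κ : ι → Type*} {A : ι → Set X}
    (hA : Pairwise (fun i j => Disjoint (A i) (A j))) {H : ∀ i, κ i → 𝔖}
    (hH : ∀ i, IsDecomposition (H i) (A i)) :
    IsDecomposition (fun p : Σ i, κ i => H p.1 p.2) (⋃ i, A i) := by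
  constructor
  · rintro ⟨i, k⟩ ⟨j, l⟩ hne
    by_cases hij : i = j
    · subst hij
      refine (hH i).1 ?_
      rintro rfl
      exact hne rfl
    · exact (hA hij).mono ((hH i).subset k) ((hH j).subset l)
  · rw [iUnion_sigma]
    exact iUnion_congr fun i => (hH i).2

theorem IsDecomposition.sum {ι κ : Type*} {A B : Set X} (hAB : Disjoint A B) {G : ι → 𝔖}
    {H : κ → 𝔖} (hG : IsDecomposition G A) (hH : IsDecomposition H B) :
    IsDecomposition (Sum.elim G H) (A ∪ B) := by
  constructor
  · rintro (i | i) (j | j) hne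
    · exact hG.1 (fun h => hne (by rw [h]))
    · exact hAB.mono (hG.subset i) (hH.subset j)
    · exact hAB.symm.mono (hH.subset i) (hG.subset j)
    · exact hH.1 (fun h => hne (by rw [h]))
  · rw [iUnion_sum, hG.2, hH.2]; rfl

theorem Decomposable.of_mem {A : Set X} (hA : A ∈ 𝔖) : Decomposable 𝔖 A :=
  ⟨Unit, inferInstance, fun _ => ⟨A, hA⟩, fun _ _ h => (h rfl).elim, (iUnion_const A).symm⟩

theorem Decomposable.of_sUnion {C : Set (Set X)} (hC : C.Countable) (hC𝔖 : C ⊆ 𝔖)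
    (hd : C.PairwiseDisjoint id) : Decomposable 𝔖 (⋃₀ C) := by
  have := hC.to_subtype
  obtain ⟨f, hf⟩ := exists_injective_nat C
  let e := Equiv.ofInjective f hf
  refine ⟨Set.range f, inferInstance, fun i => ⟨e.symm i, hC𝔖 (e.symm i).2⟩, ?_, ?_⟩
  · intro i j hij
    exact hd (e.symm i).2 (e.symm j).2 (fun h => hij (e.symm.injective (Subtype.ext h)))
  · rw [sUnion_eq_iUnion]
    exact (Equiv.iSup_comp (g := fun c : C => (c : Set X)) e.symm).symm

theorem Decomposable.iUnion {ι : Type} [Countable ι] {A : ι → Set X}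
    (hd : Pairwise (fun i j => Disjoint (A i) (A j))) (hA : ∀ i, Decomposable 𝔖 (A i)) :
    Decomposable 𝔖 (⋃ i, A i) := by
  choose κ hκ G hG using hA
  exact ⟨Σ i, κ i, inferInstance, _, IsDecomposition.sigma hd hG⟩

theorem Decomposable.empty : Decomposable 𝔖 (∅ : Set X) :=
  ⟨Empty, inferInstance, fun i => i.elim, fun i => i.elim, by simp⟩

variable (h𝔖 : IsIntervalSystem 𝔖)
include h𝔖

theorem Decomposable.diff_mem {A B : Set X} (hA : Decomposable 𝔖 A) (hB : B ∈ 𝔖) :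
    Decomposable 𝔖 (A \ B) := by
  obtain ⟨ι, hι, G, hG⟩ := hA
  have : A \ B = ⋃ i, ((G i : Set X) \ B) := by rw [hG.2, iUnion_sdiff]
  rw [this]
  refine Decomposable.iUnion (fun i j hij => (hG.1 hij).mono sdiff_subset sdiff_subset) fun i => ?_
  obtain ⟨C, hC, hCS, hd, he⟩ := (h𝔖 _ (G i).2 B hB).1
  rw [he]
  exact Decomposable.of_sUnion hC hCS hd

theorem Decomposable.iUnion_of_mem {ι : Type*} [Countable ι] {A : ι → Set X}
    (hA : ∀ i, A i ∈ 𝔖) : Decomposable 𝔖 (⋃ i, A i) := by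
  cases isEmpty_or_nonempty ι
  · rw [iUnion_of_empty]; exact Decomposable.empty
  obtain ⟨f, hf⟩ := exists_surjective_nat ι
  rw [← hf.iUnion_comp A, ← iUnion_disjointed]
  refine Decomposable.iUnion (disjoint_disjointed fun n => A (f n)) fun n => ?_
  exact disjointedRec (p := Decomposable 𝔖) (fun t i ht => ht.diff_mem h𝔖 (hA _))
    (Decomposable.of_mem (hA _))

theorem Decomposable.iUnion' {ι : Type*} [Countable ι] {A : ι → Set X}
    (hA : ∀ i, Decomposable 𝔖 (A i)) : Decomposable 𝔖 (⋃ i, A i) := by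
  choose κ hκ G hG using hA
  have : (⋃ i, A i) = ⋃ p : Σ i, κ i, (G p.1 p.2 : Set X) := by
    rw [iUnion_sigma]
    exact iUnion_congr fun i => (hG i).2
  rw [this]
  exact Decomposable.iUnion_of_mem h𝔖 fun p => (G p.1 p.2).2

theorem Decomposable.union {A B : Set X} (hA : Decomposable 𝔖 A) (hB : Decomposable 𝔖 B) :
    Decomposable 𝔖 (A ∪ B) := by
  rw [union_eq_iUnion]
  exact Decomposable.iUnion' h𝔖 (by rintro (_ | _) <;> assumption)

theorem Decomposable.inter {A B : Set X} (hA : Decomposable 𝔖 A) (hB : Decomposable 𝔖 B) :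
    Decomposable 𝔖 (A ∩ B) := by
  obtain ⟨ι, hι, G, hG⟩ := hA
  obtain ⟨κ, hκ, H, hH⟩ := hB
  rw [hG.2, hH.2, iUnion_inter_iUnion]
  refine Decomposable.iUnion' h𝔖 fun i => Decomposable.iUnion' h𝔖 fun j => ?_
  obtain ⟨C, hC, hCS, hd, he⟩ := (h𝔖 _ (G i).2 _ (H j).2).2
  rw [he]
  exact Decomposable.of_sUnion hC hCS hd

theorem Decomposable.diff_of_forall {A B : Set X} (hA : Decomposable 𝔖 A)
    (hB : ∀ E ∈ 𝔖, Decomposable 𝔖 (E \ B)) : Decomposable 𝔖 (A \ B) := by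
  obtain ⟨ι, hι, G, hG⟩ := hA
  rw [hG.2, iUnion_sdiff]
  exact Decomposable.iUnion' h𝔖 fun i => hB _ (G i).2

end Decompositions

/-! ### Extension of the measure to a ring of sets. -/

section Extension

variable {X W : Type*} {𝔖 : Set (Set X)} [AddCommGroup W] [UniformSpace W] [IsUniformAddGroup W] [T2Space W]

/-- The sets which are countable disjoint unions of members of `𝔖`, have the same property
relative to each member of `𝔖`, and for which `μ` is summable along all decompositions. -/
def summableRing (μ : 𝔖 → W) : Set (Set X) :=
  {R | Decomposable 𝔖 R ∧ (∀ E ∈ 𝔖, Decomposable 𝔖 (E \ R)) ∧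
    ∀ (ι : Type) [Countable ι] (G : ι → 𝔖), IsDecomposition G R → Summable fun i => μ (G i)}

open Classical in
/-- The extension of `μ` to the countable disjoint unions of members of `𝔖`. -/
noncomputable def extend (μ : 𝔖 → W) (R : Set X) : W :=
  if h : Decomposable 𝔖 R then ∑' i, μ (h.choose_spec.choose_spec.choose i) else 0

variable {μ : 𝔖 → W}

omit [T2Space W] in
theorem IsMeasure.hasSum_of_refinement (hμ : IsMeasure μ) {ι : Type} {κ : ι → Type} [∀ i, Countable (κ i)]
    {G : ι → 𝔖} {H : ∀ i, κ i → 𝔖} (hH : ∀ i, IsDecomposition (H i) (G i)) {z : W}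
    (hz : HasSum (fun p : Σ i, κ i => μ (H p.1 p.2)) z) : HasSum (fun i => μ (G i)) z :=
  hz.sigma fun i => hμ (κ i) (H i) (G i) (hH i).1 (hH i).2

omit [T2Space W] in
-- A decomposition of `A` together with one of `R \ A` decomposes `R`; by completeness, a subfamily
-- of a summable family is summable.
theorem summable_of_subset [CompleteSpace W] {R : Set X} (hR : R ∈ summableRing μ)
    {ι : Type} [Countable ι]
    {G : ι → 𝔖} {A : Set X} (hG : IsDecomposition G A) (hA : A ⊆ R)
    (hd : Decomposable 𝔖 (R \ A)) : Summable fun i => μ (G i) := by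
  obtain ⟨κ, hκ, H, hH⟩ := hd
  have := hG.sum disjoint_sdiff_right hH
  rw [union_sdiff_cancel hA] at this
  exact (hR.2.2 _ _ this).comp_injective Sum.inl_injective

omit [IsUniformAddGroup W] [T2Space W] in
theorem IsMeasure.mem_summableRing_of_mem (hμ : IsMeasure μ) (h𝔖 : IsIntervalSystem 𝔖) {E : Set X} (hE : E ∈ 𝔖) :
    E ∈ summableRing μ :=
  ⟨Decomposable.of_mem hE, fun _ hF => (Decomposable.of_mem hF).diff_mem h𝔖 hE,
    fun ι _ G hG => ⟨_, hμ ι G ⟨E, hE⟩ hG.1 hG.2⟩⟩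

theorem IsMeasure.isSetRing_summableRing [CompleteSpace W] (hμ : IsMeasure μ)
    (h𝔖 : IsIntervalSystem 𝔖) :
    MeasureTheory.IsSetRing (summableRing μ) where
  empty_mem := by
    refine ⟨Decomposable.empty, fun E hE => by simpa using Decomposable.of_mem hE, ?_⟩
    intro ι _ G hG
    have h0 : ∀ i, μ (G i) = 0 := by
      intro i
      have hi : (G i : Set X) = ∅ := subset_empty_iff.mp (hG.subset i)
      have := hμ Empty (fun i => i.elim) (G i) (fun i => i.elim) (by simp [hi])
      exact this.unique hasSum_empty
    simp only [h0, summable_zero]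
  sdiff_mem := by
    intro R S hR hS
    refine ⟨hR.1.diff_of_forall h𝔖 hS.2.1, fun E hE => ?_, fun ι _ G hG => ?_⟩
    · have : E \ (R \ S) = (E \ R) ∪ (E ∩ S) := by
        ext x; simp only [mem_sdiff, mem_union, mem_inter_iff]; tauto
      rw [this]
      exact (hR.2.1 E hE).union h𝔖 ((Decomposable.of_mem hE).inter h𝔖 hS.1)
    · refine summable_of_subset hR hG sdiff_subset ?_
      rw [Set.sdiff_sdiff_right_self]
      exact hR.1.inter h𝔖 hS.1
  union_mem := by
    intro R S hR hS
    refine ⟨hR.1.union h𝔖 hS.1, fun E hE => ?_, fun ι _ G hG => ?_⟩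
    · rw [← sdiff_sdiff]
      exact (hR.2.1 E hE).diff_of_forall h𝔖 hS.2.1
    · have h1 : ∀ i, Decomposable 𝔖 (G i ∩ R) := fun i =>
        (Decomposable.of_mem (G i).2).inter h𝔖 hR.1
      have h2 : ∀ i, Decomposable 𝔖 (G i \ R) := fun i => hR.2.1 _ (G i).2
      choose κ hκ H hH using h1
      choose κ' hκ' H' hH' using h2
      have hRd : IsDecomposition (fun p : Σ i, κ i => H p.1 p.2) R := by
        have := IsDecomposition.sigma
          (fun i j hij => (hG.1 hij).mono inter_subset_left inter_subset_left) hH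
        rwa [← iUnion_inter, ← hG.2, inter_eq_right.mpr subset_union_left] at this
      have hSd : IsDecomposition (fun p : Σ i, κ' i => H' p.1 p.2) (S \ R) := by
        have := IsDecomposition.sigma
          (fun i j hij => (hG.1 hij).mono sdiff_subset sdiff_subset) hH'
        rwa [← iUnion_sdiff, ← hG.2, union_sdiff_left] at this
      have s1 := hR.2.2 _ _ hRd
      have s2 := summable_of_subset hS hSd sdiff_subset
        (by rw [Set.sdiff_sdiff_right_self]; exact hS.1.inter h𝔖 hR.1)
      have s3 : HasSum (fun q : (Σ i, κ i) ⊕ (Σ i, κ' i) =>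
          μ (Sum.elim (fun p => H p.1 p.2) (fun p => H' p.1 p.2) q)) _ :=
        HasSum.sum s1.hasSum s2.hasSum
      rw [← (Equiv.sigmaSumDistrib κ κ').hasSum_iff] at s3
      have s4 : Summable (fun p : Σ i, κ i ⊕ κ' i => μ (Sum.elim (H p.1) (H' p.1) p.2)) := by
        convert s3.summable using 1
        ext ⟨i, (k | k)⟩ <;> rfl
      refine (hμ.hasSum_of_refinement (H := fun i => Sum.elim (H i) (H' i)) (fun i => ?_)
        s4.hasSum).summable
      have := (hH i).sum (disjoint_sdiff_right.mono_left inter_subset_right) (hH' i)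
      rwa [inter_union_sdiff] at this

/-- Any two decompositions have a common refinement, which is summable and can be grouped along
either of them. Hence `extend` does not depend on the chosen decomposition. -/
theorem IsMeasure.hasSum_tsum_of_decompositions [CompleteSpace W] (hμ : IsMeasure μ) (h𝔖 : IsIntervalSystem 𝔖)
    {R : Set X} (hR : R ∈ summableRing μ) {ι ι' : Type} [Countable ι] [Countable ι'] {G : ι → 𝔖}
    {G' : ι' → 𝔖} (hG : IsDecomposition G R) (hG' : IsDecomposition G' R) :
    HasSum (fun i => μ (G i)) (∑' i, μ (G' i)) := by
  have h1 : ∀ i j, Decomposable 𝔖 (G i ∩ G' j : Set X) := fun i j =>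
    (Decomposable.of_mem (G i).2).inter h𝔖 (Decomposable.of_mem (G' j).2)
  choose κ hκ H hH using h1
  have hi : ∀ i, IsDecomposition (fun p : Σ j, κ i j => H i p.1 p.2) (G i : Set X) := by
    intro i
    have := IsDecomposition.sigma
      (fun j j' hj => (hG'.1 hj).mono inter_subset_right inter_subset_right) (hH i)
    rwa [← inter_iUnion, ← hG'.2, inter_eq_left.mpr (hG.subset i)] at this
  have hj : ∀ j, IsDecomposition (fun p : Σ i, κ i j => H p.1 j p.2) (G' j : Set X) := by
    intro j
    have := IsDecomposition.sigma
      (fun i i' hi => (hG.1 hi).mono inter_subset_left inter_subset_left) (fun i => hH i j)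
    rwa [← iUnion_inter, ← hG.2, inter_eq_right.mpr (hG'.subset j)] at this
  have hall := IsDecomposition.sigma hG.1 hi
  rw [← hG.2] at hall
  obtain ⟨z, hz⟩ := hR.2.2 _ _ hall
  have hz1 := hμ.hasSum_of_refinement hi hz
  let e : (Σ j, Σ i, κ i j) ≃ (Σ i, Σ j, κ i j) :=
    ⟨fun p => ⟨p.2.1, p.1, p.2.2⟩, fun p => ⟨p.2.1, p.1, p.2.2⟩, fun _ => rfl, fun _ => rfl⟩
  have hz2 := hμ.hasSum_of_refinement hj (e.hasSum_iff.mpr hz)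
  rw [hz2.tsum_eq]
  exact hz1

theorem IsMeasure.hasSum_extend [CompleteSpace W] (hμ : IsMeasure μ) (h𝔖 : IsIntervalSystem 𝔖)
    {R : Set X} (hR : R ∈ summableRing μ) {ι : Type} [Countable ι] {G : ι → 𝔖}
    (hG : IsDecomposition G R) : HasSum (fun i => μ (G i)) (extend μ R) := by
  have hd := hR.1
  rw [extend, dif_pos hd]
  have := hd.choose_spec.choose
  exact hμ.hasSum_tsum_of_decompositions h𝔖 hR hG hd.choose_spec.choose_spec.choose_spec

end Extension

/-! ### Axioms for a `σ`-additive extension to a ring. -/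

section RingExtension

variable {X W : Type*} {𝔖 : Set (Set X)} [AddCommGroup W] [TopologicalSpace W]

/-- `ν` is a `σ`-additive extension of `μ` to the ring `ℛ`, each member of which is a countable
disjoint union of members of `𝔖`. -/
structure IsRingExtension (μ : 𝔖 → W) (ℛ : Set (Set X)) (ν : Set X → W) : Prop where
  isSetRing : MeasureTheory.IsSetRing ℛ
  mem (E : 𝔖) : (E : Set X) ∈ ℛ
  decomposable {R : Set X} : R ∈ ℛ → Decomposable 𝔖 R
  apply_mem (E : 𝔖) : ν E = μ E
  hasSum {ι : Type} [Countable ι] {A : ι → Set X} : (∀ i, A i ∈ ℛ) →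
    Pairwise (fun i j => Disjoint (A i) (A j)) → (⋃ i, A i) ∈ ℛ →
    HasSum (fun i => ν (A i)) (ν (⋃ i, A i))

end RingExtension

theorem IsMeasure.isRingExtension {X W : Type*} {𝔖 : Set (Set X)} [AddCommGroup W]
    [UniformSpace W] [IsUniformAddGroup W] [T2Space W] [CompleteSpace W] {μ : 𝔖 → W}
    (hμ : IsMeasure μ) (h𝔖 : IsIntervalSystem 𝔖) :
    IsRingExtension μ (summableRing μ) (extend μ) where
  isSetRing := hμ.isSetRing_summableRing h𝔖
  mem E := hμ.mem_summableRing_of_mem h𝔖 E.2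
  decomposable h := h.1
  apply_mem E := by
    have hd : IsDecomposition (fun _ : Unit => E) (E : Set X) :=
      ⟨fun _ _ h => (h rfl).elim, (iUnion_const _).symm⟩
    have := hμ.hasSum_extend h𝔖 (hμ.mem_summableRing_of_mem h𝔖 E.2) hd
    exact this.unique (by simp)
  hasSum {ι} _ A hA hd hU := by
    choose κ hκ G hG using fun i => (hA i).1
    have := hμ.hasSum_extend h𝔖 hU (IsDecomposition.sigma hd hG)
    exact this.sigma fun i => hμ.hasSum_extend h𝔖 (hA i) (hG i)

/-! ### Step functions over the ring and their indefinite integrals. -/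

section Steps

variable {X W : Type*} [AddCommGroup W] [Module ℝ W]

/-- `u` is a step function over `ℛ` whose integral over `R` with respect to `ν` is `φ R`. -/
inductive StepOn (ℛ : Set (Set X)) (ν : Set X → W) : (X → ℝ) → (Set X → W) → Prop
  | zero : StepOn ℛ ν (fun _ => 0) (fun _ => 0)
  | add_indicator {u : X → ℝ} {φ : Set X → W} (c : ℝ) {E : Set X} (hE : E ∈ ℛ)
      (h : StepOn ℛ ν u φ) :
      StepOn ℛ ν (fun x => u x + E.indicator (fun _ => c) x) (fun R => φ R + c • ν (E ∩ R))

namespace StepOn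

variable {ℛ : Set (Set X)} {ν : Set X → W} {u v : X → ℝ} {φ ψ : Set X → W}

theorem congr (h : StepOn ℛ ν u φ) (hu : ∀ x, u x = v x) (hφ : ∀ R, φ R = ψ R) :
    StepOn ℛ ν v ψ := by
  rw [funext hu, funext hφ] at h
  exact h

theorem add (hu : StepOn ℛ ν u φ) (hv : StepOn ℛ ν v ψ) :
    StepOn ℛ ν (fun x => u x + v x) (fun R => φ R + ψ R) := by
  induction hv with
  | zero => simpa using hu
  | add_indicator c hE _ ih =>
    exact (ih.add_indicator c hE).congr (fun x => by ring) (fun R => add_assoc _ _ _)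

theorem smul (a : ℝ) (hu : StepOn ℛ ν u φ) :
    StepOn ℛ ν (fun x => a * u x) (fun R => a • φ R) := by
  induction hu with
  | zero => simpa using StepOn.zero
  | add_indicator c hE _ ih =>
    refine (ih.add_indicator (a * c) hE).congr (fun x => ?_) (fun R => ?_)
    · rw [mul_add, indicator_const_mul]
    · rw [smul_add, smul_smul]

theorem sub (hu : StepOn ℛ ν u φ) (hv : StepOn ℛ ν v ψ) :
    StepOn ℛ ν (fun x => u x - v x) (fun R => φ R - ψ R) :=
  (hu.add (hv.smul (-1))).congr (fun x => by ring) (fun R => by rw [neg_one_smul, sub_eq_add_neg])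

theorem indicator_const {E : Set X} (hE : E ∈ ℛ) (c : ℝ) :
    StepOn ℛ ν (E.indicator fun _ => c) (fun R => c • ν (E ∩ R)) :=
  (StepOn.zero.add_indicator c hE).congr (fun x => by simp) (fun R => by simp)

theorem finset_sum {ι : Type*} (F : Finset ι) {u : ι → X → ℝ} {φ : ι → Set X → W}
    (h : ∀ i ∈ F, StepOn ℛ ν (u i) (φ i)) :
    StepOn ℛ ν (fun x => ∑ i ∈ F, u i x) (fun R => ∑ i ∈ F, φ i R) := by
  classical
  induction F using Finset.induction_on with
  | empty => simpa using StepOn.zero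
  | insert i F hi ih =>
    simp only [Finset.sum_insert hi]
    exact (h i (F.mem_insert_self i)).add (ih fun j hj => h j (Finset.mem_insert_of_mem hj))

theorem indicator {A : Set X} (hA : ∀ D ∈ ℛ, D ∩ A ∈ ℛ) (hu : StepOn ℛ ν u φ) :
    StepOn ℛ ν (A.indicator u) (fun R => φ (A ∩ R)) := by
  induction hu with
  | zero => simpa using StepOn.zero
  | @add_indicator u φ c E hE _ ih =>
    refine (ih.add_indicator c (hA E hE)).congr (fun x => ?_) (fun R => ?_)
    · by_cases hx : x ∈ A <;> by_cases hxE : x ∈ E <;> simp [hx, hxE, Set.indicator]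
    · rw [inter_assoc]

variable {𝔖 : Set (Set X)} [TopologicalSpace W] {μ : 𝔖 → W}

theorem exists_support (h : IsRingExtension μ ℛ ν) (hu : StepOn ℛ ν u φ) :
    ∃ P ∈ ℛ, ∀ Q, P ⊆ Q → (∀ x ∉ Q, u x = 0) ∧ ∀ R, φ (R ∩ Q) = φ R := by
  induction hu with
  | zero => exact ⟨∅, h.isSetRing.empty_mem, fun _ _ => ⟨fun _ _ => rfl, fun _ => rfl⟩⟩
  | @add_indicator u φ c E hE _ ih =>
    obtain ⟨P, hP, hPQ⟩ := ih
    refine ⟨P ∪ E, h.isSetRing.union_mem hP hE, fun Q hQ => ?_⟩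
    obtain ⟨h1, h2⟩ := hPQ Q (subset_union_left.trans hQ)
    have hEQ : E ⊆ Q := subset_union_right.trans hQ
    refine ⟨fun x hx => ?_, fun R => ?_⟩
    · beta_reduce
      rw [h1 x hx, indicator_of_notMem (fun hxE => hx (hEQ hxE)), add_zero]
    · beta_reduce
      rw [h2, inter_comm R Q, ← inter_assoc, inter_eq_left.mpr hEQ]

theorem level_mem (h : IsRingExtension μ ℛ ν) (hu : StepOn ℛ ν u φ) :
    ∀ (a : ℝ), ∀ R ∈ ℛ, {x ∈ R | u x = a} ∈ ℛ := by
  induction hu with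
  | zero =>
    intro a R hR
    by_cases ha : 0 = a
    · simpa [ha] using hR
    · simpa [ha] using h.isSetRing.empty_mem
  | @add_indicator u φ c E hE _ ih =>
    intro a R hR
    have : {x ∈ R | u x + E.indicator (fun _ => c) x = a} =
        {x ∈ R ∩ E | u x = a - c} ∪ {x ∈ R \ E | u x = a} := by
      ext x
      by_cases hx : x ∈ E <;> simp [hx, eq_sub_iff_add_eq]
    rw [this]
    exact h.isSetRing.union_mem (ih _ _ (h.isSetRing.inter_mem hR hE))
      (ih _ _ (h.isSetRing.sdiff_mem hR hE))

omit [TopologicalSpace W] in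
theorem countable_range (hu : StepOn ℛ ν u φ) : (range u).Countable := by
  induction hu with
  | zero => exact (countable_singleton (0 : ℝ)).mono (range_subset_iff.mpr fun _ => mem_singleton 0)
  | @add_indicator u φ c E hE _ ih =>
    refine ((ih.image fun y => y + c).union ih).mono (range_subset_iff.mpr fun x => ?_)
    by_cases hx : x ∈ E
    · exact Or.inl ⟨u x, mem_range_self x, by simp [hx]⟩
    · exact Or.inr ⟨x, by simp [hx]⟩

theorem support_mem (h : IsRingExtension μ ℛ ν) (hu : StepOn ℛ ν u φ) : {x | u x ≠ 0} ∈ ℛ := by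
  obtain ⟨P, hP, hPQ⟩ := hu.exists_support h
  have : {x | u x ≠ 0} = P \ {x ∈ P | u x = 0} := by
    ext x
    have := (hPQ P subset_rfl).1 x
    simp only [mem_ofPred_eq, mem_sdiff]
    tauto
  rw [this]
  exact h.isSetRing.sdiff_mem hP (hu.level_mem h 0 P hP)

variable [IsTopologicalAddGroup W] [ContinuousConstSMul ℝ W]

theorem hasSum (h : IsRingExtension μ ℛ ν) (hu : StepOn ℛ ν u φ) {ι : Type} [Countable ι]
    {A : ι → Set X} (hA : ∀ i, A i ∈ ℛ) (hd : Pairwise fun i j => Disjoint (A i) (A j))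
    (hU : (⋃ i, A i) ∈ ℛ) : HasSum (fun i => φ (A i)) (φ (⋃ i, A i)) := by
  induction hu with
  | zero => exact hasSum_zero
  | @add_indicator u φ c E hE _ ih =>
    refine ih.add (HasSum.const_smul c ?_)
    rw [inter_iUnion]
    refine h.hasSum (fun i => h.isSetRing.inter_mem hE (hA i))
      (fun i j hij => (hd hij).mono inter_subset_right inter_subset_right) ?_
    rw [← inter_iUnion]
    exact h.isSetRing.inter_mem hE hU

variable [T2Space W]

theorem apply_empty (h : IsRingExtension μ ℛ ν) (hu : StepOn ℛ ν u φ) : φ ∅ = 0 := by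
  have := hu.hasSum h (ι := Empty) (A := fun i => i.elim) (fun i => i.elim) (fun i => i.elim)
    (by simpa using h.isSetRing.empty_mem)
  rw [iUnion_of_empty] at this
  exact this.unique hasSum_empty

theorem apply_union (h : IsRingExtension μ ℛ ν) (hu : StepOn ℛ ν u φ) {A B : Set X}
    (hA : A ∈ ℛ) (hB : B ∈ ℛ) (hd : Disjoint A B) : φ (A ∪ B) = φ A + φ B := by
  have := hu.hasSum h (ι := Bool) (A := fun b => cond b A B)
    (by rintro (_ | _) <;> assumption)
    (by rintro (_ | _) (_ | _) hij <;> first | exact (hij rfl).elim | exact hd | exact hd.symm)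
    (by rw [← union_eq_iUnion]; exact h.isSetRing.union_mem hA hB)
  rw [← union_eq_iUnion] at this
  exact this.unique (by simpa using hasSum_fintype fun b : Bool => φ (cond b A B))

theorem apply_inter_add_sdiff (h : IsRingExtension μ ℛ ν) (hu : StepOn ℛ ν u φ) {A B : Set X}
    (hA : A ∈ ℛ) (hB : B ∈ ℛ) : φ (A ∩ B) + φ (A \ B) = φ A := by
  rw [← hu.apply_union h (h.isSetRing.inter_mem hA hB) (h.isSetRing.sdiff_mem hA hB)
    (disjoint_sdiff_right.mono_left inter_subset_right), inter_union_sdiff]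

theorem apply_finset_biUnion (h : IsRingExtension μ ℛ ν) (hu : StepOn ℛ ν u φ) {ι : Type*}
    {A : ι → Set X} (hA : ∀ i, A i ∈ ℛ) (hd : Pairwise fun i j => Disjoint (A i) (A j))
    (F : Finset ι) : φ (⋃ i ∈ F, A i) = ∑ i ∈ F, φ (A i) := by
  classical
  induction F using Finset.induction_on with
  | empty => simpa using hu.apply_empty h
  | insert i F hi ih =>
    rw [Finset.sum_insert hi, ← ih, Finset.set_biUnion_insert]
    refine hu.apply_union h (hA i) (h.isSetRing.biUnion_mem F fun j _ => hA j) ?_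
    refine disjoint_iUnion₂_right.mpr fun j hj => hd ?_
    rintro rfl
    exact hi hj

theorem measure_inter_add_sdiff (h : IsRingExtension μ ℛ ν) {A B : Set X}
    (hA : A ∈ ℛ) (hB : B ∈ ℛ) : ν (A ∩ B) + ν (A \ B) = ν A := by
  have := (indicator_const (ν := ν) hA 1).apply_inter_add_sdiff h hA hB
  simpa [inter_eq_right.mpr (inter_subset_left : A ∩ B ⊆ A),
    inter_eq_right.mpr (sdiff_subset : A \ B ⊆ A)] using this

/-- This makes the integral independent of the representation of `u`: on sets of constancy only the
value of `u` counts. For empty `R` the number `a` is arbitrary, so `ν ∅ = 0` is needed. -/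
theorem apply_of_const (h : IsRingExtension μ ℛ ν) (hu : StepOn ℛ ν u φ) :
    ∀ (a : ℝ), ∀ R ∈ ℛ, (∀ x ∈ R, u x = a) → φ R = a • ν R := by
  have hν0 : ν ∅ = 0 := by
    simpa using (indicator_const (ν := ν) h.isSetRing.empty_mem 1).apply_empty h
  induction hu with
  | zero =>
    intro a R hR ha
    rcases R.eq_empty_or_nonempty with rfl | ⟨x, hx⟩
    · rw [hν0, smul_zero]
    · rw [← ha x hx, zero_smul]
  | @add_indicator u φ c E hE hu ih =>
    intro a R hR ha
    beta_reduce at ha ⊢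
    have hRE := h.isSetRing.inter_mem hR hE
    have hRE' := h.isSetRing.sdiff_mem hR hE
    rw [← hu.apply_inter_add_sdiff h hR hE, ← measure_inter_add_sdiff h hR hE,
      ih (a - c) _ hRE fun x hx => by rw [← ha x hx.1, indicator_of_mem hx.2, add_sub_cancel_right],
      ih a _ hRE' fun x hx => by rw [← ha x hx.1, indicator_of_notMem hx.2, add_zero],
      inter_comm E R, sub_smul, smul_add]
    abel

/-- Since `univ` need not belong to `ℛ`, additivity does not apply to it directly. First replace it
by a member of `ℛ` outside of which the representation of `u` has no terms. -/
theorem univ_eq (h : IsRingExtension μ ℛ ν) (hu : StepOn ℛ ν u φ) {Q : Set X}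
    (hQ : Q ∈ ℛ) (h0 : ∀ x ∉ Q, u x = 0) : φ univ = φ Q := by
  obtain ⟨P, hP, hPQ⟩ := hu.exists_support h
  rw [← (hPQ (P ∪ Q) subset_union_left).2, univ_inter, ← sdiff_union_self,
    hu.apply_union h (h.isSetRing.sdiff_mem hP hQ) hQ disjoint_sdiff_left,
    hu.apply_of_const h 0 _ (h.isSetRing.sdiff_mem hP hQ) fun x hx => h0 x hx.2, zero_smul, zero_add]

theorem unique (h : IsRingExtension μ ℛ ν) (hu : StepOn ℛ ν u φ) (hu' : StepOn ℛ ν u ψ) :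
    φ univ = ψ univ := by
  have h0 := hu.sub hu'
  have := h0.univ_eq h h.isSetRing.empty_mem fun x _ => sub_self (u x)
  rw [h0.apply_empty h] at this
  exact sub_eq_zero.mp this

end StepOn
end Steps
-- From countable covers by cells to decompositions.
section Cells

variable {X : Type*}

/-- `Q` is covered by countably many sets `D ∈ ℛ` such that each `x ∈ Q` lies in some `D` with
`P x D`. -/
def HasCells (ℛ : Set (Set X)) (Q : Set X) (P : X → Set X → Prop) : Prop :=
  ∃ 𝔇 : Set (Set X), 𝔇.Countable ∧ 𝔇 ⊆ ℛ ∧ ∀ x ∈ Q, ∃ D ∈ 𝔇, x ∈ D ∧ P x D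

variable {ℛ : Set (Set X)} {Q : Set X} {P P' : X → Set X → Prop}

theorem HasCells.and (hℛ : MeasureTheory.IsSetRing ℛ) (h : HasCells ℛ Q P)
    (h' : HasCells ℛ Q P') (hP : ∀ x D G, G ⊆ D → P x D → P x G)
    (hP' : ∀ x D G, G ⊆ D → P' x D → P' x G) : HasCells ℛ Q fun x D => P x D ∧ P' x D := by
  obtain ⟨𝔇, hc, hs, hx⟩ := h
  obtain ⟨𝔇', hc', hs', hx'⟩ := h'
  refine ⟨image2 (· ∩ ·) 𝔇 𝔇', hc.image2 hc' _, ?_, fun x hxQ => ?_⟩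
  · rintro _ ⟨D, hD, D', hD', rfl⟩
    exact hℛ.inter_mem (hs hD) (hs' hD')
  · obtain ⟨D, hD, hxD, h1⟩ := hx x hxQ
    obtain ⟨D', hD', hxD', h2⟩ := hx' x hxQ
    exact ⟨D ∩ D', mem_image2_of_mem hD hD', ⟨hxD, hxD'⟩, hP _ _ _ inter_subset_left h1,
      hP' _ _ _ inter_subset_right h2⟩

theorem HasCells.exists_decomposition {W : Type*} [AddCommGroup W] [TopologicalSpace W]
    {𝔖 : Set (Set X)} {μ : 𝔖 → W} {ν : Set X → W} (h : IsRingExtension μ ℛ ν)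
    (hP : ∀ x D G, G ⊆ D → P x D → P x G) (hQ : Q ∈ ℛ) (hc : HasCells ℛ Q P) :
    ∃ (ι : Type) (_ : Countable ι) (G : ι → 𝔖) (p : ι → X), IsDecomposition G Q ∧
      ∀ i, P (p i) (G i) := by
  obtain ⟨𝔇, hc, hs, hx⟩ := hc
  rcases Q.eq_empty_or_nonempty with rfl | ⟨x₀, hx₀⟩
  · exact ⟨Empty, inferInstance, fun i => i.elim, fun i => i.elim,
      ⟨fun i => i.elim, by simp⟩, fun i => i.elim⟩
  -- Cells without a witness are dropped, so that each remaining cell has one. The witness `p n`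
  -- need not lie in `D n`; only the property `P` matters.
  set 𝔇' := {D ∈ 𝔇 | ∃ x, P x D} with h𝔇'
  have hne : 𝔇'.Nonempty := by
    obtain ⟨D, hD, -, h1⟩ := hx x₀ hx₀
    exact ⟨D, hD, x₀, h1⟩
  obtain ⟨D, hD⟩ := (hc.mono (sep_subset _ _) : 𝔇'.Countable).exists_eq_range hne
  have hDp : ∀ n, D n ∈ ℛ ∧ ∃ x, P x (D n) := by
    intro n
    have : D n ∈ 𝔇' := hD ▸ mem_range_self n
    exact ⟨hs this.1, this.2⟩
  choose hDℛ p hp using hDp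
  have hdec : ∀ n, Decomposable 𝔖 (disjointed D n ∩ Q) := fun n =>
    h.decomposable (h.isSetRing.inter_mem (h.isSetRing.disjointed_mem hDℛ n) hQ)
  choose κ hκ G hG using hdec
  refine ⟨Σ n, κ n, inferInstance, fun q => G q.1 q.2, fun i => p i.1, ?_, ?_⟩
  · have := IsDecomposition.sigma (fun i j hij =>
      (disjoint_disjointed D hij).mono inter_subset_left inter_subset_left) hG
    rw [← iUnion_inter, iUnion_disjointed, inter_eq_right.mpr] at this
    · exact this
    · intro x hxQ
      obtain ⟨E, hE, hxE, h1⟩ := hx x hxQ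
      have : E ∈ range D := hD ▸ ⟨hE, x, h1⟩
      obtain ⟨n, rfl⟩ := this
      exact mem_iUnion.mpr ⟨n, hxE⟩
  · rintro ⟨n, k⟩
    exact hP _ _ _ (((hG n).subset k).trans (inter_subset_left.trans (disjointed_subset D n)))
      (hp n)

end Cells

/-! ### Step functions along decompositions. -/

section Steps

variable {X W : Type*} [AddCommGroup W] [Module ℝ W] [TopologicalSpace W]
  {𝔖 ℛ : Set (Set X)} {μ : 𝔖 → W} {ν : Set X → W} {u : X → ℝ} {φ : Set X → W}

omit [TopologicalSpace W] in
theorem StepOn.mono {𝔗 : Set (Set X)} (h𝔗 : 𝔗 ⊆ ℛ) (hu : StepOn 𝔗 ν u φ) : StepOn ℛ ν u φ := by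
  induction hu with
  | zero => exact .zero
  | add_indicator c hE _ ih => exact ih.add_indicator c (h𝔗 hE)

theorem StepOn.hasCells (h : IsRingExtension μ ℛ ν) (hu : StepOn ℛ ν u φ) {Q : Set X}
    (hQ : Q ∈ ℛ) : HasCells ℛ Q fun x D => ∀ y ∈ D, u y = u x := by
  refine ⟨(fun a => {x ∈ Q | u x = a}) '' range u, hu.countable_range.image _, ?_, ?_⟩
  · rintro _ ⟨a, -, rfl⟩
    exact hu.level_mem h a Q hQ
  · exact fun x hx => ⟨_, ⟨u x, mem_range_self x, rfl⟩, ⟨hx, rfl⟩, fun y hy => hy.2⟩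

variable [IsTopologicalAddGroup W] [ContinuousConstSMul ℝ W] [T2Space W]

theorem StepOn.hasSum_decomposition (h : IsRingExtension μ ℛ ν) (hu : StepOn ℛ ν u φ) {Q : Set X}
    (hQ : Q ∈ ℛ) (h0 : ∀ x ∉ Q, u x = 0) {ι : Type} [Countable ι] {G : ι → 𝔖}
    (hG : IsDecomposition G Q) {a : ι → ℝ} (ha : ∀ i, ∀ y ∈ (G i : Set X), u y = a i) :
    HasSum (fun i => a i • μ (G i)) (φ univ) := by
  have := hu.hasSum h (fun i => h.mem (G i)) hG.1 (hG.2 ▸ hQ)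
  rw [← hG.2, ← hu.univ_eq h hQ h0] at this
  convert this using 2 with i
  rw [hu.apply_of_const h (a i) _ (h.mem (G i)) (ha i), h.apply_mem]

/-- A step function in `𝒜` can be modified on finitely many members of a decomposition. -/
theorem exists_step_near {𝔗 : Set (Set X)} (h : IsRingExtension μ ℛ ν) (h𝔖 : 𝔖 ⊆ 𝔗) (h𝔗 : 𝔗 ⊆ ℛ)
    {𝒜 : Set (ℝ × X)} {s : X → ℝ} {σ : Set X → W} (hs : StepOn 𝔗 ν s σ)
    (hs𝒜 : Approximates 𝒜 s) {Q : Set X} (hQ : Q ∈ ℛ) (h0 : ∀ x ∉ Q, s x = 0)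
    {ι : Type} [Countable ι] {G : ι → 𝔖} (hG : IsDecomposition G Q) {a : ι → ℝ}
    (ha : ∀ i, ∀ y ∈ (G i : Set X), s y = a i) {v : ι → ℝ}
    (hv : ∀ i, ∀ y ∈ (G i : Set X), (v i, y) ∈ 𝒜) {T : Set W} (hT : T ∈ 𝓝 0) :
    ∀ᶠ F : Finset ι in Filter.atTop, ∃ u φ, StepOn 𝔗 ν u φ ∧ Approximates 𝒜 u ∧
      φ univ - ∑ i ∈ F, v i • μ (G i) ∈ T := by
  have hsum := (hs.mono h𝔗).hasSum_decomposition h hQ h0 hG ha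
  have hlim : Filter.Tendsto (fun F : Finset ι => σ univ - ∑ i ∈ F, a i • μ (G i))
      Filter.atTop (𝓝 0) := by
    have := (tendsto_const_nhds (x := σ univ)).sub hsum
    rwa [sub_self] at this
  filter_upwards [hlim hT] with F hF
  -- Replace the value `a i` of `s` by `v i` on the pieces in `F`. What is left of the integral of
  -- `s` is a tail of a convergent series.
  refine ⟨_, _, hs.add (StepOn.finset_sum F fun i _ =>
    StepOn.indicator_const (ν := ν) (h𝔖 (G i).2) (v i - a i)), fun x => ?_, ?_⟩
  · beta_reduce
    by_cases hx : ∃ i ∈ F, x ∈ (G i : Set X)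
    · obtain ⟨i, hi, hxi⟩ := hx
      rw [Finset.sum_eq_single i, indicator_of_mem hxi, ha i x hxi, add_sub_cancel]
      · exact hv i x hxi
      · exact fun j _ hj => indicator_of_notMem
          (fun hxj => (hG.1 hj).le_bot ⟨hxj, hxi⟩) _
      · exact fun hi' => (hi' hi).elim
    · push Not at hx
      rw [Finset.sum_eq_zero fun i hi => indicator_of_notMem (hx i hi) _, add_zero]
      exact hs𝒜 x
  · have : σ univ + ∑ i ∈ F, (v i - a i) • ν ((G i : Set X) ∩ univ) - ∑ i ∈ F, v i • μ (G i) =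
        σ univ - ∑ i ∈ F, a i • μ (G i) := by
      simp only [inter_univ, h.apply_mem, sub_smul, Finset.sum_sub_distrib]
      abel
    rw [this]
    exact hF

end Steps

/-! ### Envelopes over the ring and uniqueness of the integral. -/

section RingEnvelopes

variable {X W : Type*} [AddCommGroup W] [Module ℝ W]

/-- Envelopes with respect to a ring `ℛ`: `𝒜` contains the graph of the step function `s` over
`ℛ`, and the points of `𝒜` not on the common zero set of `s` and `0` are covered by the
rectangles in `𝒜` over the members of the countable set `𝔇`. -/
structure RingEnvelope (ℛ : Set (Set X)) (ν : Set X → W) (𝒜 : Set (ℝ × X)) (s : X → ℝ)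
    (σ : Set X → W) (𝔇 : Set (Set X)) : Prop where
  step : StepOn ℛ ν s σ
  approximates : Approximates 𝒜 s
  countable : 𝔇.Countable
  subset : 𝔇 ⊆ ℛ
  cell : ∀ v x, (v, x) ∈ 𝒜 → (v ≠ 0 ∨ s x ≠ 0) → ∃ D ∈ 𝔇, x ∈ D ∧ ∀ y ∈ D, (v, y) ∈ 𝒜

/-- All integrals of step functions over `ℛ` with graph in `𝒜` are in `S`. -/
def StepIntegralsIn (ℛ : Set (Set X)) (ν : Set X → W) (𝒜 : Set (ℝ × X)) (S : Set W) : Prop :=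
  ∀ u φ, StepOn ℛ ν u φ → Approximates 𝒜 u → φ univ ∈ S

/-- The integral defined by means of envelopes and step functions over `ℛ`. -/
def HasRingIntegral [TopologicalSpace W] (ℛ : Set (Set X)) (ν : Set X → W) (f : X → ℝ) (a : W) :
    Prop :=
  ∀ T ∈ 𝓝 (0 : W), ∃ 𝒜 s σ 𝔇, RingEnvelope ℛ ν 𝒜 s σ 𝔇 ∧ Approximates 𝒜 f ∧
    StepIntegralsIn ℛ ν 𝒜 {z | z - a ∈ T}

variable [TopologicalSpace W]

omit [Module ℝ W] in
theorem exists_symmetric_nhds [IsTopologicalAddGroup W] {T : Set W} (hT : T ∈ 𝓝 0) :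
    ∃ V ∈ 𝓝 (0 : W), (∀ x ∈ V, -x ∈ V) ∧
      ∀ a ∈ V, ∀ b ∈ V, ∀ c ∈ V, ∀ d ∈ V, a + b + c + d ∈ T := by
  obtain ⟨V, hV, h4⟩ := exists_nhds_zero_quarter hT
  refine ⟨V ∩ -V, Filter.inter_mem hV (neg_mem_nhds_zero W hV), fun x hx => ⟨hx.2, ?_⟩,
    fun a ha b hb c hc d hd => h4 ha.1 hb.1 hc.1 hd.1⟩
  simpa using hx.1

variable {𝔖 ℛ : Set (Set X)} {μ : 𝔖 → W} {ν : Set X → W} {𝒜 ℬ : Set (ℝ × X)}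
  {s t : X → ℝ} {σ τ : Set X → W} {𝔇 𝔈 : Set (Set X)} {f g : X → ℝ} {a b : W}

/-- Points where both `f` and `s` vanish have no cell in `𝔇`; there the zero set of `s` within `Q`
serves as a single cell, since `s` has its graph in `𝒜`. No measurability of `f` is needed. -/
theorem RingEnvelope.hasCells (h : IsRingExtension μ ℛ ν) (hA : RingEnvelope ℛ ν 𝒜 s σ 𝔇)
    (hf : Approximates 𝒜 f) {Q : Set X} (hQ : Q ∈ ℛ) :
    HasCells ℛ Q fun x D => ∀ y ∈ D, (f x, y) ∈ 𝒜 := by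
  have hQs := h.isSetRing.sdiff_mem hQ (hA.step.support_mem h)
  refine ⟨insert (Q \ {x | s x ≠ 0}) 𝔇, hA.countable.insert _, insert_subset hQs hA.subset,
    fun x hx => ?_⟩
  by_cases hc : f x ≠ 0 ∨ s x ≠ 0
  · obtain ⟨D, hD, h1⟩ := hA.cell _ x (hf x) hc
    exact ⟨D, mem_insert_of_mem _ hD, h1⟩
  · push Not at hc
    refine ⟨_, mem_insert _ _, ⟨hx, by simpa using hc.2⟩, fun y hy => ?_⟩
    have hy0 : s y = 0 := by simpa using hy.2
    rw [hc.1, ← hy0]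
    exact hA.approximates y

variable [IsTopologicalAddGroup W] [ContinuousConstSMul ℝ W] [T2Space W]

/-- On a common decomposition the value `f (p i)` is admissible over `G i` for both envelopes.
Inserting these values on the same finite set of pieces brings both integrals close to `∑ f (p i) μ
(G i)`. Uniqueness of the integral and the Cauchy criterion follow from this. -/
theorem RingEnvelope.exists_step_sub_mem (h : IsRingExtension μ ℛ ν)
    (hA : RingEnvelope ℛ ν 𝒜 s σ 𝔇) (hB : RingEnvelope ℛ ν ℬ t τ 𝔈) (hfA : Approximates 𝒜 f)
    (hfB : Approximates ℬ f) {T : Set W} (hT : T ∈ 𝓝 0) :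
    ∃ u φ w ψ, StepOn ℛ ν u φ ∧ Approximates 𝒜 u ∧ StepOn ℛ ν w ψ ∧ Approximates ℬ w ∧
      φ univ - ψ univ ∈ T := by
  have hQ := h.isSetRing.union_mem (hA.step.support_mem h) (hB.step.support_mem h)
  have h1 := ((hA.hasCells h hfA hQ).and h.isSetRing (hB.hasCells h hfB hQ)
    (fun x D G hGD hD y hy => hD y (hGD hy)) (fun x D G hGD hD y hy => hD y (hGD hy)))
  have h2 := ((hA.step.hasCells h hQ).and h.isSetRing (hB.step.hasCells h hQ)
    (fun x D G hGD hD y hy => hD y (hGD hy)) (fun x D G hGD hD y hy => hD y (hGD hy)))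
  obtain ⟨ι, _, G, p, hG, hp⟩ := (h1.and h.isSetRing h2
    (fun x D G hGD hD => ⟨fun y hy => hD.1 y (hGD hy), fun y hy => hD.2 y (hGD hy)⟩)
    (fun x D G hGD hD => ⟨fun y hy => hD.1 y (hGD hy), fun y hy => hD.2 y (hGD hy)⟩)
    ).exists_decomposition h
    (fun x D G hGD hD => ⟨⟨fun y hy => hD.1.1 y (hGD hy), fun y hy => hD.1.2 y (hGD hy)⟩,
      ⟨fun y hy => hD.2.1 y (hGD hy), fun y hy => hD.2.2 y (hGD hy)⟩⟩) hQ
  obtain ⟨V, hV, hneg, h4⟩ := exists_symmetric_nhds hT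
  have hsub : 𝔖 ⊆ ℛ := fun E hE => h.mem ⟨E, hE⟩
  obtain ⟨F, ⟨u, φ, hu, huA, huV⟩, ⟨w, ψ, hw, hwB, hwV⟩⟩ :=
    ((exists_step_near h hsub subset_rfl hA.step hA.approximates hQ
      (fun x hx => by_contra fun hx' => hx (Or.inl hx')) hG (fun i => (hp i).2.1)
      (fun i => (hp i).1.1) hV).and
    (exists_step_near h hsub subset_rfl hB.step hB.approximates hQ
      (fun x hx => by_contra fun hx' => hx (Or.inr hx')) hG (fun i => (hp i).2.2)
      (fun i => (hp i).1.2) hV)).exists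
  refine ⟨u, φ, w, ψ, hu, huA, hw, hwB, ?_⟩
  have := h4 _ huV _ (hneg _ hwV) 0 (mem_of_mem_nhds hV) 0 (mem_of_mem_nhds hV)
  convert this using 1
  abel

theorem RingEnvelope.exists_step_sub_integral_mem (h : IsRingExtension μ ℛ ν)
    (hA : RingEnvelope ℛ ν 𝒜 s σ 𝔇) (hfA : Approximates 𝒜 f) (hf : HasRingIntegral ℛ ν f a)
    {T : Set W} (hT : T ∈ 𝓝 0) :
    ∃ u φ, StepOn ℛ ν u φ ∧ Approximates 𝒜 u ∧ φ univ - a ∈ T := by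
  obtain ⟨V, hV, hneg, h4⟩ := exists_symmetric_nhds hT
  obtain ⟨ℬ, t, τ, 𝔈, hB, hfB, hBV⟩ := hf V hV
  obtain ⟨u, φ, w, ψ, hu, huA, hw, hwB, huw⟩ := hA.exists_step_sub_mem h hB hfA hfB hV
  refine ⟨u, φ, hu, huA, ?_⟩
  have := h4 _ huw _ (hBV w ψ hw hwB) 0 (mem_of_mem_nhds hV) 0 (mem_of_mem_nhds hV)
  convert this using 1
  abel

theorem RingEnvelope.mem_of_isClosed (h : IsRingExtension μ ℛ ν)
    (hA : RingEnvelope ℛ ν 𝒜 s σ 𝔇) (hfA : Approximates 𝒜 f) (hf : HasRingIntegral ℛ ν f a)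
    {S : Set W} (hS : IsClosed S) (hAS : StepIntegralsIn ℛ ν 𝒜 S) : a ∈ S := by
  rw [← hS.closure_eq, mem_closure_iff_nhds_zero]
  intro U hU
  obtain ⟨u, φ, hu, huA, huU⟩ := hA.exists_step_sub_integral_mem h hfA hf hU
  exact ⟨_, hAS u φ hu huA, huU⟩

theorem HasRingIntegral.unique (h : IsRingExtension μ ℛ ν) (ha : HasRingIntegral ℛ ν f a)
    (hb : HasRingIntegral ℛ ν f b) : a = b := by
  refine sub_eq_zero.mp ?_
  by_contra hne
  obtain ⟨V, hV, hneg, h4⟩ := exists_symmetric_nhds (isOpen_compl_singleton.mem_nhds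
    (Ne.symm hne : (0 : W) ∈ ({a - b}ᶜ : Set W)))
  obtain ⟨𝒜, s, σ, 𝔇, hA, hfA, hAV⟩ := ha V hV
  obtain ⟨u, φ, hu, huA, hub⟩ := hA.exists_step_sub_integral_mem h hfA hb hV
  refine h4 _ hub _ (hneg _ (hAV u φ hu huA)) 0 (mem_of_mem_nhds hV) 0 (mem_of_mem_nhds hV) ?_
  simp

end RingEnvelopes
-- Linearity of the integral.
section RingIntegral

variable {X W : Type*} [AddCommGroup W] [Module ℝ W]
  {𝔖 ℛ : Set (Set X)} {ν : Set X → W} {𝒜 ℬ : Set (ℝ × X)}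
  {s t : X → ℝ} {σ τ : Set X → W} {𝔇 𝔈 : Set (Set X)} {f g : X → ℝ} {a b : W}

/-- The fiberwise linear combination `α 𝒜 + β ℬ`. -/
def combination (α β : ℝ) (𝒜 ℬ : Set (ℝ × X)) : Set (ℝ × X) :=
  {p | ∃ v w, (v, p.2) ∈ 𝒜 ∧ (w, p.2) ∈ ℬ ∧ p.1 = α * v + β * w}

/-- The restriction of `𝒜` to `B`, extended by zero. -/
def restriction (B : Set X) (𝒜 : Set (ℝ × X)) : Set (ℝ × X) :=
  {p | (p.2 ∈ B → p ∈ 𝒜) ∧ (p.2 ∉ B → p.1 = 0)}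

theorem Approximates.combination (hf : Approximates 𝒜 f) (hg : Approximates ℬ g) (α β : ℝ) :
    Approximates (combination α β 𝒜 ℬ) fun x => α * f x + β * g x :=
  fun x => ⟨f x, g x, hf x, hg x, rfl⟩

theorem Approximates.restriction (hf : Approximates 𝒜 f) (B : Set X) :
    Approximates (restriction B 𝒜) (B.indicator f) := by
  intro x
  refine ⟨fun hx => ?_, fun hx => indicator_of_notMem hx f⟩
  rw [indicator_of_mem hx]
  exact hf x

variable [TopologicalSpace W] {μ : 𝔖 → W}

/-- If one summand has value zero at a point where its step function vanishes, it provides no cell;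
the cell of the other summand is then cut down to the zero set of that step function. -/
theorem RingEnvelope.combination (h : IsRingExtension μ ℛ ν) (hA : RingEnvelope ℛ ν 𝒜 s σ 𝔇)
    (hB : RingEnvelope ℛ ν ℬ t τ 𝔈) (α β : ℝ) :
    RingEnvelope ℛ ν (combination α β 𝒜 ℬ) (fun x => α * s x + β * t x)
      (fun R => α • σ R + β • τ R)
      (image2 (· ∩ ·) 𝔇 𝔈 ∪ ((· \ {x | t x ≠ 0}) '' 𝔇 ∪ (· \ {x | s x ≠ 0}) '' 𝔈)) where
  step := (hA.step.smul α).add (hB.step.smul β)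
  approximates := hA.approximates.combination hB.approximates α β
  countable := (hA.countable.image2 hB.countable _).union
    ((hA.countable.image _).union (hB.countable.image _))
  subset := by
    refine union_subset ?_ (union_subset ?_ ?_)
    · rintro _ ⟨D, hD, E, hE, rfl⟩
      exact h.isSetRing.inter_mem (hA.subset hD) (hB.subset hE)
    · rintro _ ⟨D, hD, rfl⟩
      exact h.isSetRing.sdiff_mem (hA.subset hD) (hB.step.support_mem h)
    · rintro _ ⟨D, hD, rfl⟩
      exact h.isSetRing.sdiff_mem (hB.subset hD) (hA.step.support_mem h)
  cell := by
    rintro r x ⟨v, w, hv, hw, hr⟩ hne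
    simp only at hv hw hr
    by_cases h1 : v ≠ 0 ∨ s x ≠ 0 <;> by_cases h2 : w ≠ 0 ∨ t x ≠ 0
    · obtain ⟨D, hD, hxD, hDv⟩ := hA.cell v x hv h1
      obtain ⟨E, hE, hxE, hEw⟩ := hB.cell w x hw h2
      exact ⟨D ∩ E, Or.inl (mem_image2_of_mem hD hE), ⟨hxD, hxE⟩,
        fun y hy => ⟨v, w, hDv y hy.1, hEw y hy.2, hr⟩⟩
    · obtain ⟨D, hD, hxD, hDv⟩ := hA.cell v x hv h1
      push Not at h2
      refine ⟨_, Or.inr (Or.inl ⟨D, hD, rfl⟩), ⟨hxD, by simpa using h2.2⟩,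
        fun y hy => ⟨v, w, hDv y hy.1, ?_, hr⟩⟩
      have hy0 : t y = 0 := by simpa using hy.2
      rw [h2.1, ← hy0]
      exact hB.approximates y
    · obtain ⟨E, hE, hxE, hEw⟩ := hB.cell w x hw h2
      push Not at h1
      refine ⟨_, Or.inr (Or.inr ⟨E, hE, rfl⟩), ⟨hxE, by simpa using h1.2⟩,
        fun y hy => ⟨v, w, ?_, hEw y hy.1, hr⟩⟩
      have hy0 : s y = 0 := by simpa using hy.2
      rw [h1.1, ← hy0]
      exact hA.approximates y
    · push Not at h1 h2
      rcases hne with hne | hne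
      · exact (hne (by rw [hr, h1.1, h2.1]; ring)).elim
      · exact (hne (by rw [h1.2, h2.2]; ring)).elim

omit [TopologicalSpace W] in
theorem RingEnvelope.restriction (hA : RingEnvelope ℛ ν 𝒜 s σ 𝔇) {B : Set X}
    (hB : ∀ D ∈ ℛ, D ∩ B ∈ ℛ) :
    RingEnvelope ℛ ν (restriction B 𝒜) (B.indicator s) (fun R => σ (B ∩ R)) ((· ∩ B) '' 𝔇) where
  step := hA.step.indicator hB
  approximates := hA.approximates.restriction B
  countable := hA.countable.image _
  subset := by
    rintro _ ⟨D, hD, rfl⟩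
    exact hB D (hA.subset hD)
  cell := by
    rintro v x ⟨h1, h2⟩ hne
    by_cases hx : x ∈ B
    · rw [indicator_of_mem hx] at hne
      obtain ⟨D, hD, hxD, hDv⟩ := hA.cell v x (h1 hx) hne
      exact ⟨_, ⟨D, hD, rfl⟩, ⟨hxD, hx⟩,
        fun y hy => ⟨fun _ => hDv y hy.1, fun hy' => (hy' hy.2).elim⟩⟩
    · rw [indicator_of_notMem hx] at hne
      rcases hne with hne | hne
      · exact (hne (h2 hx)).elim
      · exact (hne rfl).elim

variable [IsTopologicalAddGroup W] [ContinuousConstSMul ℝ W] [T2Space W]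

theorem RingEnvelope.combination_approx (h : IsRingExtension μ ℛ ν)
    (hA : RingEnvelope ℛ ν 𝒜 s σ 𝔇) (hB : RingEnvelope ℛ ν ℬ t τ 𝔈) {α β : ℝ} {u : X → ℝ}
    {φ : Set X → W} (hu : StepOn ℛ ν u φ) (huC : Approximates (LebesgueMcShane.combination α β 𝒜 ℬ) u)
    {T : Set W} (hT : T ∈ 𝓝 0) :
    ∃ u₁ φ₁ u₂ φ₂, StepOn ℛ ν u₁ φ₁ ∧ Approximates 𝒜 u₁ ∧ StepOn ℛ ν u₂ φ₂ ∧ Approximates ℬ u₂ ∧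
      φ univ - (α • φ₁ univ + β • φ₂ univ) ∈ T := by
  -- The selections `v`, `w` are arbitrary functions, which is harmless because
  -- `RingEnvelope.hasCells` holds for every function with graph in the envelope.
  choose v w hv hw hvw using huC
  have hQ := h.isSetRing.union_mem (hu.support_mem h)
    (h.isSetRing.union_mem (hA.step.support_mem h) (hB.step.support_mem h))
  have h1 := ((hA.hasCells h hv hQ).and h.isSetRing (hB.hasCells h hw hQ)
    (fun x D G hGD hD y hy => hD y (hGD hy)) (fun x D G hGD hD y hy => hD y (hGD hy)))
  have h2 := ((hA.step.hasCells h hQ).and h.isSetRing (hB.step.hasCells h hQ)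
    (fun x D G hGD hD y hy => hD y (hGD hy)) (fun x D G hGD hD y hy => hD y (hGD hy)))
  have h3 := (h1.and h.isSetRing h2
    (fun x D G hGD hD => ⟨fun y hy => hD.1 y (hGD hy), fun y hy => hD.2 y (hGD hy)⟩)
    (fun x D G hGD hD => ⟨fun y hy => hD.1 y (hGD hy), fun y hy => hD.2 y (hGD hy)⟩)).and
    h.isSetRing (hu.hasCells h hQ)
    (fun x D G hGD hD => ⟨⟨fun y hy => hD.1.1 y (hGD hy), fun y hy => hD.1.2 y (hGD hy)⟩,
      ⟨fun y hy => hD.2.1 y (hGD hy), fun y hy => hD.2.2 y (hGD hy)⟩⟩)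
    (fun x D G hGD hD y hy => hD y (hGD hy))
  obtain ⟨ι, _, G, p, hG, hp⟩ := h3.exists_decomposition h
    (fun x D G hGD hD => ⟨⟨⟨fun y hy => hD.1.1.1 y (hGD hy), fun y hy => hD.1.1.2 y (hGD hy)⟩,
      ⟨fun y hy => hD.1.2.1 y (hGD hy), fun y hy => hD.1.2.2 y (hGD hy)⟩⟩,
      fun y hy => hD.2 y (hGD hy)⟩) hQ
  obtain ⟨V, hV, hneg, h4⟩ := exists_symmetric_nhds hT
  have hsub : 𝔖 ⊆ ℛ := fun E hE => h.mem ⟨E, hE⟩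
  have hα : (fun z : W => α • z) ⁻¹' V ∈ 𝓝 0 :=
    (continuous_const_smul α).continuousAt.preimage_mem_nhds (by rwa [smul_zero])
  have hβ : (fun z : W => β • z) ⁻¹' V ∈ 𝓝 0 :=
    (continuous_const_smul β).continuousAt.preimage_mem_nhds (by rwa [smul_zero])
  have hsum := hu.hasSum_decomposition h hQ
    (fun x hx => by_contra fun hx' => hx (Or.inl hx')) hG (fun i => (hp i).2)
  have hlim : Filter.Tendsto (fun F : Finset ι => φ univ - ∑ i ∈ F, u (p i) • μ (G i))
      Filter.atTop (𝓝 0) := by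
    have := (tendsto_const_nhds (x := φ univ)).sub hsum
    rwa [sub_self] at this
  obtain ⟨F, ⟨⟨u₁, φ₁, hu₁, huA, h₁⟩, ⟨u₂, φ₂, hu₂, huB, h₂⟩⟩, h₃⟩ :=
    (((exists_step_near h hsub subset_rfl hA.step hA.approximates hQ
      (fun x hx => by_contra fun hx' => hx (Or.inr (Or.inl hx'))) hG (fun i => (hp i).1.2.1)
      (fun i => (hp i).1.1.1) hα).and
    (exists_step_near h hsub subset_rfl hB.step hB.approximates hQ
      (fun x hx => by_contra fun hx' => hx (Or.inr (Or.inr hx'))) hG (fun i => (hp i).1.2.2)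
      (fun i => (hp i).1.1.2) hβ)).and (hlim hV)).exists
  refine ⟨u₁, φ₁, u₂, φ₂, hu₁, huA, hu₂, huB, ?_⟩
  have := h4 _ h₃ _ (hneg _ h₁) _ (hneg _ h₂) 0 (mem_of_mem_nhds hV)
  convert this using 1
  have : ∑ i ∈ F, u (p i) • μ (G i) =
      α • ∑ i ∈ F, v (p i) • μ (G i) + β • ∑ i ∈ F, w (p i) • μ (G i) := by
    rw [Finset.smul_sum, Finset.smul_sum, ← Finset.sum_add_distrib]
    refine Finset.sum_congr rfl fun i _ => ?_
    have := hvw (p i)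
    simp only at this
    rw [this, add_smul, mul_smul, mul_smul]
  beta_reduce
  rw [this, smul_sub, smul_sub]
  abel

theorem HasRingIntegral.combination (h : IsRingExtension μ ℛ ν) (hf : HasRingIntegral ℛ ν f a)
    (hg : HasRingIntegral ℛ ν g b) (α β : ℝ) :
    HasRingIntegral ℛ ν (fun x => α * f x + β * g x) (α • a + β • b) := by
  intro T hT
  obtain ⟨V, hV, hneg, h4⟩ := exists_symmetric_nhds hT
  have hα : (fun z : W => α • z) ⁻¹' V ∈ 𝓝 0 :=
    (continuous_const_smul α).continuousAt.preimage_mem_nhds (by rwa [smul_zero])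
  have hβ : (fun z : W => β • z) ⁻¹' V ∈ 𝓝 0 :=
    (continuous_const_smul β).continuousAt.preimage_mem_nhds (by rwa [smul_zero])
  obtain ⟨𝒜, s, σ, 𝔇, hA, hfA, hAV⟩ := hf _ hα
  obtain ⟨ℬ, t, τ, 𝔈, hB, hgB, hBV⟩ := hg _ hβ
  refine ⟨_, _, _, _, hA.combination h hB α β, hfA.combination hgB α β, fun u φ hu huC => ?_⟩
  obtain ⟨u₁, φ₁, u₂, φ₂, hu₁, huA, hu₂, huB, h₃⟩ := hA.combination_approx h hB hu huC hV
  have := h4 _ h₃ _ (hAV u₁ φ₁ hu₁ huA) _ (hBV u₂ φ₂ hu₂ huB) 0 (mem_of_mem_nhds hV)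
  simp only [mem_ofPred_eq]
  convert this using 1
  beta_reduce
  rw [smul_sub, smul_sub]
  abel

theorem HasRingIntegral.zero (h : IsRingExtension μ ℛ ν) :
    HasRingIntegral ℛ ν (fun _ => 0) 0 := by
  intro T hT
  refine ⟨{0} ×ˢ univ, _, _, ∅, ⟨StepOn.zero, fun x => ⟨rfl, trivial⟩, countable_empty,
    empty_subset _, fun v x hv hne => ?_⟩, fun x => ⟨rfl, trivial⟩, fun u φ hu huA => ?_⟩
  · exact (hne.elim (fun h => h hv.1) (fun h => h rfl)).elim
  · have := hu.univ_eq h h.isSetRing.empty_mem fun x _ => (huA x).1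
    rw [hu.apply_empty h] at this
    simpa [this] using mem_of_mem_nhds hT

theorem HasRingIntegral.add (h : IsRingExtension μ ℛ ν) (hf : HasRingIntegral ℛ ν f a)
    (hg : HasRingIntegral ℛ ν g b) : HasRingIntegral ℛ ν (fun x => f x + g x) (a + b) := by
  simpa using hf.combination h hg 1 1

theorem HasRingIntegral.sub (h : IsRingExtension μ ℛ ν) (hf : HasRingIntegral ℛ ν f a)
    (hg : HasRingIntegral ℛ ν g b) : HasRingIntegral ℛ ν (fun x => f x - g x) (a - b) := by
  simpa [← sub_eq_add_neg] using hf.combination h hg 1 (-1)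

theorem HasRingIntegral.finset_sum (h : IsRingExtension μ ℛ ν) {ι : Type*} (F : Finset ι)
    {f : ι → X → ℝ} {a : ι → W} (hf : ∀ i ∈ F, HasRingIntegral ℛ ν (f i) (a i)) :
    HasRingIntegral ℛ ν (fun x => ∑ i ∈ F, f i x) (∑ i ∈ F, a i) := by
  classical
  induction F using Finset.induction_on with
  | empty => simpa using HasRingIntegral.zero h
  | insert i F hi ih =>
    simp only [Finset.sum_insert hi]
    exact (hf i (F.mem_insert_self i)).add h (ih fun j hj => hf j (Finset.mem_insert_of_mem hj))

/-- A function close to integrable functions up to envelopes with small integrals is integrable. -/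
theorem hasRingIntegral_of_near (h : IsRingExtension μ ℛ ν)
    (hf : ∀ T ∈ 𝓝 (0 : W), ∃ g b 𝒞 s σ 𝔇, HasRingIntegral ℛ ν g b ∧ b - a ∈ T ∧
      RingEnvelope ℛ ν 𝒞 s σ 𝔇 ∧ Approximates 𝒞 (fun x => f x - g x) ∧
      StepIntegralsIn ℛ ν 𝒞 T) : HasRingIntegral ℛ ν f a := by
  intro T hT
  obtain ⟨V, hV, hneg, h4⟩ := exists_symmetric_nhds hT
  obtain ⟨g, b, 𝒞, t, τ, 𝔈, hg, hba, hC, hfgC, hCV⟩ := hf V hV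
  obtain ⟨𝒜, s, σ, 𝔇, hA, hgA, hAV⟩ := hg V hV
  have hfA := hgA.combination hfgC 1 1
  simp only [one_mul, add_sub_cancel] at hfA
  refine ⟨_, _, _, _, hA.combination h hC 1 1, hfA, fun u φ hu huC => ?_⟩
  obtain ⟨u₁, φ₁, u₂, φ₂, hu₁, huA, hu₂, huB, h₃⟩ := hA.combination_approx h hC hu huC hV
  have := h4 _ h₃ _ (hAV u₁ φ₁ hu₁ huA) _ (hCV u₂ φ₂ hu₂ huB) _ hba
  simp only [mem_ofPred_eq]
  convert this using 1
  rw [one_smul, one_smul]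
  abel

end RingIntegral

/-! ### Cauchy criterion and integrability over subsets. -/

section Completeness

variable {X W : Type*} [AddCommGroup W] [Module ℝ W] [UniformSpace W] [IsUniformAddGroup W]
  [ContinuousConstSMul ℝ W] [T2Space W] [CompleteSpace W]
  {𝔖 ℛ : Set (Set X)} {μ : 𝔖 → W} {ν : Set X → W} {f : X → ℝ} {a : W}

/-- A Cauchy criterion: `f` has an integral if it has envelopes in which the integrals of step
functions have arbitrarily small oscillation. -/
theorem exists_hasRingIntegral_of_oscillation (h : IsRingExtension μ ℛ ν)
    (hf : ∀ T ∈ 𝓝 (0 : W), ∃ 𝒜 s σ 𝔇, RingEnvelope ℛ ν 𝒜 s σ 𝔇 ∧ Approximates 𝒜 f ∧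
      ∀ u φ w ψ, StepOn ℛ ν u φ → Approximates 𝒜 u → StepOn ℛ ν w ψ → Approximates 𝒜 w →
        φ univ - ψ univ ∈ T) : ∃ a, HasRingIntegral ℛ ν f a := by
  -- Step integrals from envelopes of oscillation within `T`. As `T` shrinks these sets generate a
  -- Cauchy filter, whose limit is the integral.
  let B : Set W → Set W := fun T => {z | ∃ 𝒜 s σ 𝔇, RingEnvelope ℛ ν 𝒜 s σ 𝔇 ∧
    Approximates 𝒜 f ∧ (∀ u φ w ψ, StepOn ℛ ν u φ → Approximates 𝒜 u → StepOn ℛ ν w ψ →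
      Approximates 𝒜 w → φ univ - ψ univ ∈ T) ∧ ∃ u φ, StepOn ℛ ν u φ ∧ Approximates 𝒜 u ∧
      z = φ univ}
  have hB : Monotone B := by
    rintro T T' hT z ⟨𝒜, s, σ, 𝔇, h1, h2, h3, h4⟩
    exact ⟨𝒜, s, σ, 𝔇, h1, h2, fun u φ w ψ a b c d => hT (h3 u φ w ψ a b c d), h4⟩
  have hne : ((𝓝 (0 : W)).lift' B).NeBot := by
    rw [Filter.lift'_neBot_iff hB]
    intro T hT
    obtain ⟨𝒜, s, σ, 𝔇, h1, h2, h3⟩ := hf T hT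
    exact ⟨_, 𝒜, s, σ, 𝔇, h1, h2, h3, s, σ, h1.step, h1.approximates, rfl⟩
  have hcauchy : Cauchy ((𝓝 (0 : W)).lift' B) := by
    refine ⟨hne, ?_⟩
    rw [uniformity_eq_comap_nhds_zero]
    intro U hU
    obtain ⟨T, hT, hTU⟩ := Filter.mem_comap.mp hU
    obtain ⟨V, hV, hneg, h4⟩ := exists_symmetric_nhds hT
    refine Filter.mem_of_superset
      (Filter.prod_mem_prod (Filter.mem_lift' hV) (Filter.mem_lift' hV)) ?_
    rintro ⟨z, z'⟩ ⟨⟨𝒜, s, σ, 𝔇, hA, hfA, hAV, u, φ, hu, huA, rfl⟩,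
      ⟨ℬ, t, τ, 𝔈, hB, hfB, hBV, w, ψ, hw, hwB, rfl⟩⟩
    obtain ⟨u', φ', w', ψ', hu', huA', hw', hwB', h5⟩ := hA.exists_step_sub_mem h hB hfA hfB hV
    refine hTU ?_
    have := h4 _ (hAV _ _ _ _ hu' huA' hu huA) _ (hneg _ h5) _ (hBV _ _ _ _ hw hwB hw' hwB') 0
      (mem_of_mem_nhds hV)
    simp only [mem_preimage]
    convert this using 1
    abel
  obtain ⟨a, ha⟩ := CompleteSpace.complete hcauchy
  refine ⟨a, fun T hT => ?_⟩
  obtain ⟨V, hV, hneg, h4⟩ := exists_symmetric_nhds hT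
  have hVa : {z | z - a ∈ V} ∈ 𝓝 a := by
    refine ContinuousAt.preimage_mem_nhds (f := fun z => z - a) (by fun_prop) ?_
    rwa [sub_self]
  obtain ⟨z, hz, ⟨𝒜, s, σ, 𝔇, hA, hfA, hAV, u, φ, hu, huA, rfl⟩⟩ :=
    Filter.nonempty_of_mem (Filter.inter_mem (ha hVa) (Filter.mem_lift' hV))
  refine ⟨𝒜, s, σ, 𝔇, hA, hfA, fun w ψ hw hwA => ?_⟩
  have := h4 _ (hAV _ _ _ _ hw hwA hu huA) _ hz 0 (mem_of_mem_nhds hV) 0 (mem_of_mem_nhds hV)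
  simp only [mem_ofPred_eq]
  convert this using 1
  abel

theorem HasRingIntegral.exists_indicator (h : IsRingExtension μ ℛ ν)
    (hf : HasRingIntegral ℛ ν f a) {B : Set X} (hB : ∀ D ∈ ℛ, D ∩ B ∈ ℛ) :
    ∃ b, HasRingIntegral ℛ ν (B.indicator f) b := by
  refine exists_hasRingIntegral_of_oscillation h fun T hT => ?_
  obtain ⟨V, hV, hneg, h4⟩ := exists_symmetric_nhds hT
  obtain ⟨𝒜, s, σ, 𝔇, hA, hfA, hAV⟩ := hf V hV
  refine ⟨_, _, _, _, hA.restriction hB, hfA.restriction B, fun u φ w ψ hu huR hw hwR => ?_⟩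
  -- Outside `B`, fill in the fixed step function `s`. This leads back into `𝒜`, and the added
  -- integral cancels in differences.
  have key : ∀ u φ, StepOn ℛ ν u φ → Approximates (restriction B 𝒜) u →
      φ univ + (σ univ - σ (B ∩ univ)) - a ∈ V := by
    intro u φ hu huR
    refine hAV _ _ (hu.add (hA.step.sub (hA.step.indicator hB))) fun x => ?_
    by_cases hx : x ∈ B
    · simpa [hx] using (huR x).1 hx
    · have : u x = 0 := (huR x).2 hx
      simpa [hx, this] using hA.approximates x
  have := h4 _ (key u φ hu huR) _ (hneg _ (key w ψ hw hwR)) 0 (mem_of_mem_nhds hV) 0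
    (mem_of_mem_nhds hV)
  convert this using 1
  abel

end Completeness
-- Equivalence of the original integral with the integral over the ring.
section Transfer

variable {X W : Type*} [AddCommGroup W] [Module ℝ W] [TopologicalSpace W]
  {𝔖 ℛ : Set (Set X)} {μ : 𝔖 → W} {ν : Set X → W} {𝒜 : Set (ℝ × X)}
  {s : X → ℝ} {σ : Set X → W} {𝔇 : Set (Set X)} {f : X → ℝ} {a : W}

omit [Module ℝ W] in
theorem IsRingExtension.subset (h : IsRingExtension μ ℛ ν) : 𝔖 ⊆ ℛ := fun E hE => h.mem ⟨E, hE⟩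

omit [TopologicalSpace W] in
theorem stepOn_stepFun (ν : Set X → W) {n : ℕ} (c : Fin n → ℝ) (E : Fin n → 𝔖) :
    StepOn 𝔖 ν (stepFun c E) (fun R => ∑ j, c j • ν (E j ∩ R)) :=
  StepOn.finset_sum _ fun j _ => StepOn.indicator_const (E j).2 (c j)

theorem StepOn.exists_stepFun (h : IsRingExtension μ ℛ ν) {u : X → ℝ} {φ : Set X → W}
    (hu : StepOn 𝔖 ν u φ) : ∃ (n : ℕ) (c : Fin n → ℝ) (E : Fin n → 𝔖),
      u = stepFun c E ∧ φ univ = ∑ j, c j • μ (E j) := by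
  induction hu with
  | zero => exact ⟨0, fun i => i.elim0, fun i => i.elim0, by ext; simp [stepFun], by simp⟩
  | @add_indicator u φ c E hE _ ih =>
    obtain ⟨n, d, D, hu, hφ⟩ := ih
    refine ⟨n + 1, Fin.snoc (α := fun _ => ℝ) d c, Fin.snoc (α := fun _ => 𝔖) D ⟨E, hE⟩, ?_, ?_⟩
    · ext x
      simp [stepFun, hu, Fin.sum_univ_castSucc]
    · simp [Fin.sum_univ_castSucc, hφ, ← h.apply_mem]

theorem preIntegral_subset (h : IsRingExtension μ ℛ ν) {S : Set W} (hS : IsClosed S)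
    (h𝒜 : StepIntegralsIn 𝔖 ν 𝒜 S) : preIntegral μ 𝒜 ⊆ S := by
  refine closure_minimal ?_ hS
  rintro z ⟨n, c, E, hE, rfl⟩
  simpa [h.apply_mem] using h𝒜 _ _ (stepOn_stepFun ν c E) hE

theorem IsEnvelope.exists_ringEnvelope (h : IsRingExtension μ ℛ ν) (h𝒜 : IsEnvelope 𝔖 𝒜) :
    ∃ s σ 𝔇, RingEnvelope ℛ ν 𝒜 s σ 𝔇 ∧ StepOn 𝔖 ν s σ := by
  obtain ⟨⟨n, c, E, hs⟩, 𝔇, hc, h𝔇, hgen⟩ := h𝒜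
  have hstep := stepOn_stepFun ν c E
  refine ⟨_, _, 𝔇, ⟨hstep.mono h.subset, hs, hc, h𝔇.trans h.subset, fun v x hv hne => ?_⟩, hstep⟩
  have key : ∀ w, (w, x) ∈ 𝒜 → w ≠ 0 → ∃ D ∈ 𝔇, x ∈ D := by
    intro w hw hw0
    rw [hgen] at hw
    rcases hw with hw | hw
    · obtain ⟨D, hD, hw⟩ := mem_iUnion₂.mp hw
      exact ⟨D, hD, hw.2⟩
    · exact (hw0 hw.1).elim
  rw [hgen] at hv
  rcases hv with hv | hv
  · obtain ⟨D, hD, hv⟩ := mem_iUnion₂.mp hv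
    exact ⟨D, hD, hv.2, hv.1⟩
  · obtain ⟨D, hD, hxD⟩ := hne.elim (fun h => (h hv.1).elim) (key _ (hs x))
    exact (hv.2 ⟨D, hD, hxD⟩).elim

omit [Module ℝ W] in
theorem IsRingExtension.exists_refinement (h : IsRingExtension μ ℛ ν) (hc : 𝔇.Countable)
    (h𝔇 : 𝔇 ⊆ ℛ) : ∃ 𝔊 : Set (Set X), 𝔊.Countable ∧ 𝔊 ⊆ 𝔖 ∧
      (∀ D ∈ 𝔇, ∀ x ∈ D, ∃ G ∈ 𝔊, x ∈ G ∧ G ⊆ D) ∧ ∀ G ∈ 𝔊, ∃ D ∈ 𝔇, G ⊆ D := by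
  choose κ hκ G hG using fun D : 𝔇 => h.decomposable (h𝔇 D.2)
  have := hc.to_subtype
  refine ⟨range fun p : Σ D, κ D => (G p.1 p.2 : Set X), countable_range _, ?_, ?_, ?_⟩
  · rintro _ ⟨p, rfl⟩
    exact (G p.1 p.2).2
  · intro D hD x hx
    have hx' : x ∈ (⟨D, hD⟩ : 𝔇).1 := hx
    rw [(hG ⟨D, hD⟩).2] at hx'
    obtain ⟨k, hk⟩ := mem_iUnion.mp hx'
    exact ⟨_, ⟨⟨⟨D, hD⟩, k⟩, rfl⟩, hk, (hG ⟨D, hD⟩).subset k⟩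
  · rintro _ ⟨p, rfl⟩
    exact ⟨p.1, p.1.2, (hG p.1).subset p.2⟩

theorem RingEnvelope.isEnvelope (h : IsRingExtension μ ℛ ν) (hA : RingEnvelope ℛ ν 𝒜 s σ 𝔇)
    (hs : StepOn 𝔖 ν s σ) : IsEnvelope 𝔖 𝒜 := by
  obtain ⟨n, c, E, rfl, -⟩ := hs.exists_stepFun h
  refine ⟨⟨n, c, E, hA.approximates⟩, ?_⟩
  set s := stepFun c E with hsdef
  -- The sets `D \ {s ≠ 0}` are included to generate the points `(0, x)` with `s x = 0` which lie
  -- over the covered region.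
  have hcD : (𝔇 ∪ (· \ {x | s x ≠ 0}) '' 𝔇).Countable := hA.countable.union (hA.countable.image _)
  have hsD : 𝔇 ∪ (· \ {x | s x ≠ 0}) '' 𝔇 ⊆ ℛ := by
    refine union_subset hA.subset ?_
    rintro _ ⟨D, hD, rfl⟩
    exact h.isSetRing.sdiff_mem (hA.subset hD) (hA.step.support_mem h)
  obtain ⟨𝔊, h𝔊c, h𝔊, h1, h2⟩ := h.exists_refinement hcD hsD
  refine ⟨𝔊, h𝔊c, h𝔊, Subset.antisymm ?_ ?_⟩
  · rintro ⟨v, x⟩ hvx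
    by_cases hne : v ≠ 0 ∨ s x ≠ 0
    · obtain ⟨D, hD, hxD, hDv⟩ := hA.cell v x hvx hne
      obtain ⟨G, hG, hxG, hGD⟩ := h1 D (Or.inl hD) x hxD
      exact Or.inl (mem_iUnion₂.mpr ⟨G, hG, fun y hy => hDv y (hGD hy), hxG⟩)
    · push Not at hne
      by_cases hx : x ∈ ⋃₀ 𝔊
      · obtain ⟨G', hG', hxG'⟩ := hx
        have hxD : ∃ D ∈ 𝔇, x ∈ D := by
          obtain ⟨D', hD' | ⟨D, hD, rfl⟩, hGD'⟩ := h2 G' hG'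
          · exact ⟨D', hD', hGD' hxG'⟩
          · exact ⟨D, hD, (hGD' hxG').1⟩
        obtain ⟨D, hD, hxD⟩ := hxD
        obtain ⟨G, hG, hxG, hGD⟩ := h1 (D \ {x | s x ≠ 0}) (Or.inr ⟨D, hD, rfl⟩) x
          ⟨hxD, by simpa using hne.2⟩
        refine Or.inl (mem_iUnion₂.mpr ⟨G, hG, fun y hy => ?_, hxG⟩)
        have hy0 : s y = 0 := by simpa using (hGD hy).2
        rw [hne.1, ← hy0]
        exact hA.approximates y
      · exact Or.inr ⟨hne.1, hx⟩
  · rintro ⟨v, x⟩ (hvx | hvx)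
    · obtain ⟨D, hD, hv, hx⟩ := mem_iUnion₂.mp hvx
      exact hv x hx
    · obtain ⟨hv, hx⟩ := hvx
      have hv : v = 0 := hv
      have hsx : s x = 0 := by
        by_contra hne
        obtain ⟨D, hD, hxD, -⟩ := hA.cell _ x (hA.approximates x) (Or.inr hne)
        obtain ⟨G, hG, hxG, -⟩ := h1 D (Or.inl hD) x hxD
        exact hx ⟨G, hG, hxG⟩
      rw [hv, ← hsx]
      exact hA.approximates x

variable [IsTopologicalAddGroup W] [ContinuousConstSMul ℝ W] [T2Space W]

/-- Step functions over `ℛ` give nothing new: transplanting the values of `u` on finitely many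
pieces into the step function over `𝔖` provided by the envelope approximates its integral. -/
theorem IsEnvelope.stepIntegralsIn (h : IsRingExtension μ ℛ ν) (h𝒜 : IsEnvelope 𝔖 𝒜) :
    StepIntegralsIn ℛ ν 𝒜 (preIntegral μ 𝒜) := by
  intro u φ hu hu𝒜
  obtain ⟨s, σ, 𝔇, hA, hs⟩ := h𝒜.exists_ringEnvelope h
  have hQ := h.isSetRing.union_mem (hu.support_mem h) (hA.step.support_mem h)
  obtain ⟨ι, _, G, p, hG, hp⟩ := ((hu.hasCells h hQ).and h.isSetRing (hA.step.hasCells h hQ)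
    (fun x D G hGD hD y hy => hD y (hGD hy)) (fun x D G hGD hD y hy => hD y (hGD hy))
    ).exists_decomposition h
    (fun x D G hGD hD => ⟨fun y hy => hD.1 y (hGD hy), fun y hy => hD.2 y (hGD hy)⟩) hQ
  have hsum := hu.hasSum_decomposition h hQ
    (fun x hx => by_contra fun hx' => hx (Or.inl hx')) hG (fun i => (hp i).1)
  rw [preIntegral, mem_closure_iff_nhds_zero]
  intro T hT
  obtain ⟨V, hV, hneg, h4⟩ := exists_symmetric_nhds hT
  have hlim : Filter.Tendsto (fun F : Finset ι => φ univ - ∑ i ∈ F, u (p i) • μ (G i))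
      Filter.atTop (𝓝 0) := by
    have := (tendsto_const_nhds (x := φ univ)).sub hsum
    rwa [sub_self] at this
  obtain ⟨F, ⟨w, ψ, hw, hwA, hwV⟩, hFV⟩ :=
    ((exists_step_near h subset_rfl h.subset hs hA.approximates hQ
      (fun x hx => by_contra fun hx' => hx (Or.inr hx')) hG (fun i => (hp i).2)
      (v := fun i => u (p i)) (fun i y hy => (hp i).1 y hy ▸ hu𝒜 y) hV).and (hlim hV)).exists
  obtain ⟨n, c, E, rfl, hψ⟩ := hw.exists_stepFun h
  refine ⟨ψ univ, ⟨n, c, E, hwA, hψ⟩, ?_⟩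
  have := h4 _ hwV _ (hneg _ hFV) 0 (mem_of_mem_nhds hV) 0 (mem_of_mem_nhds hV)
  convert this using 1
  beta_reduce
  abel

/-- An exhaustion argument. Otherwise there are disjoint sets `C (F n)`, each inside finitely many
pieces, with `σ (C (F n))` staying away from `0`. Together with the remainders of the `G i` they
decompose `P`, contradicting summability of `σ`. -/
theorem StepOn.exists_finset_forall_mem (h : IsRingExtension μ ℛ ν) (hs : StepOn ℛ ν s σ)
    {P : Set X} (hP : P ∈ ℛ) {ι : Type} [Countable ι] {G : ι → 𝔖} (hG : IsDecomposition G P)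
    {T : Set W} (hT : T ∈ 𝓝 0) :
    ∃ F : Finset ι, ∀ B ∈ ℛ, B ⊆ P \ ⋃ i ∈ F, (G i : Set X) → σ B ∈ T := by
  obtain ⟨T', hT', hclosed, hTT'⟩ := exists_mem_nhds_isClosed_subset hT
  by_contra! hcon
  have step : ∀ F : Finset ι, ∃ C ∈ ℛ, ∃ F' : Finset ι, F ⊆ F' ∧ C ⊆ ⋃ i ∈ F', (G i : Set X) ∧
      Disjoint C (⋃ i ∈ F, (G i : Set X)) ∧ σ C ∉ T' := by
    intro F
    obtain ⟨B, hB, hBP, hBT⟩ := hcon F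
    have hBG : ∀ i, B ∩ G i ∈ ℛ := fun i => h.isSetRing.inter_mem hB (h.mem (G i))
    have hBd : Pairwise fun i j => Disjoint (B ∩ G i) (B ∩ G j) := fun i j hij =>
      (hG.1 hij).mono inter_subset_right inter_subset_right
    have hBU : (⋃ i, B ∩ G i) = B := by
      rw [← inter_iUnion, ← hG.2, inter_eq_left.mpr (hBP.trans sdiff_subset)]
    have hsum := hs.hasSum h hBG hBd (by rwa [hBU])
    rw [hBU] at hsum
    obtain ⟨F', hF', hFF'⟩ := ((hsum.eventually_mem
      (hclosed.isOpen_compl.mem_nhds fun hB' => hBT (hTT' hB'))).and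
      (Filter.eventually_ge_atTop F)).exists
    refine ⟨⋃ i ∈ F', B ∩ G i, h.isSetRing.biUnion_mem F' fun i _ => hBG i, F', hFF',
      iUnion₂_mono fun i _ => inter_subset_right, ?_, ?_⟩
    · exact disjoint_sdiff_left.mono_left
        ((iUnion₂_subset fun i _ => inter_subset_left).trans hBP)
    · rw [hs.apply_finset_biUnion h hBG hBd]
      exact hF'
  choose C hC Φ hΦ hCΦ hCd hCT using step
  let F : ℕ → Finset ι := fun n => Nat.rec ∅ (fun _ F => Φ F) n
  have hF1 : ∀ n, F (n + 1) = Φ (F n) := fun n => rfl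
  have hFmono : Monotone F := monotone_nat_of_le_succ fun n => hΦ (F n)
  have hCP : ∀ n, C (F n) ⊆ P := fun n => (hCΦ (F n)).trans (iUnion₂_subset fun i _ => hG.subset i)
  have hCdis : Pairwise fun m n => Disjoint (C (F m)) (C (F n)) := by
    have key : ∀ m n, m < n → Disjoint (C (F m)) (C (F n)) := fun m n hmn =>
      ((hCd (F n)).mono_right
        ((hCΦ (F m)).trans (biUnion_subset_biUnion_left (hFmono (Nat.succ_le_of_lt hmn))))).symm
    intro m n hmn
    rcases lt_or_gt_of_ne hmn with hlt | hlt
    · exact key m n hlt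
    · exact (key n m hlt).symm
  -- Each `G i` meets only finitely many of the `C (F n)`: none from the stage on at which `i`
  -- enters `F n`, and none at all if it never does.
  have hD : ∀ i, (G i : Set X) \ ⋃ n, C (F n) ∈ ℛ := by
    intro i
    obtain ⟨N, hN⟩ : ∃ N, ∀ n, N ≤ n → Disjoint (C (F n)) (G i) := by
      by_cases hi : ∃ n, i ∈ F n
      · obtain ⟨N, hN⟩ := hi
        exact ⟨N, fun n hn => (hCd (F n)).mono_right
          (subset_biUnion_of_mem (u := fun i => (G i : Set X)) (hFmono hn hN))⟩
      · push Not at hi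
        refine ⟨0, fun n _ => Disjoint.mono_left (hCΦ (F n)) (disjoint_iUnion₂_left.mpr ?_)⟩
        exact fun j hj => hG.1 fun hji => hi (n + 1) (hji ▸ hj)
    have : (G i : Set X) \ ⋃ n, C (F n) = (G i : Set X) \ ⋃ n ∈ Finset.range N, C (F n) := by
      ext x
      simp only [mem_sdiff, mem_iUnion, Finset.mem_range, not_exists]
      refine and_congr_right fun hx => ⟨fun hn n _ => hn n, fun hn n hxn => ?_⟩
      rcases lt_or_ge n N with hlt | hge
      · exact hn n hlt hxn
      · exact (hN n hge).le_bot ⟨hxn, hx⟩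
    rw [this]
    exact h.isSetRing.sdiff_mem (h.mem (G i)) (h.isSetRing.biUnion_mem _ fun n _ => hC (F n))
  have hU : (⋃ k : ι ⊕ ℕ, Sum.elim (fun i => (G i : Set X) \ ⋃ n, C (F n))
      (fun n => C (F n)) k) = P := by
    rw [iUnion_sum]
    simp only [Sum.elim_inl, Sum.elim_inr]
    rw [← iUnion_sdiff, ← hG.2, sdiff_union_of_subset (iUnion_subset hCP)]
  have hsum := hs.hasSum h (A := Sum.elim (fun i => (G i : Set X) \ ⋃ n, C (F n))
      (fun n => C (F n))) (by rintro (i | n); exacts [hD i, hC (F n)])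
    (by
      rintro (i | m) (j | n) hne
      · exact (hG.1 fun hij => hne (by rw [hij])).mono sdiff_subset sdiff_subset
      · exact disjoint_sdiff_left.mono_right (subset_iUnion (fun n => C (F n)) n)
      · exact disjoint_sdiff_right.mono_left (subset_iUnion (fun n => C (F n)) m)
      · exact hCdis fun hmn => hne (by rw [hmn]))
    (by rwa [hU])
  have hlim := hsum.summable.tendsto_cofinite_zero.comp
    (Sum.inr_injective (α := ι) (β := ℕ)).tendsto_cofinite
  obtain ⟨n, hn⟩ := (hlim.eventually_mem hT').exists
  exact hCT (F n) hn

/-- The step function `s` over `ℛ` may need infinitely many members of `𝔖`, so it is cut off outside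
a finite union `U` of pieces and zero is admitted off `U`. The effect on integrals is a value of `σ`
on a subset of the discarded part, which is small. -/
theorem RingEnvelope.exists_isEnvelope (h : IsRingExtension μ ℛ ν)
    (hA : RingEnvelope ℛ ν 𝒜 s σ 𝔇) {S : Set W} (hAS : StepIntegralsIn ℛ ν 𝒜 S) {T : Set W}
    (hT : T ∈ 𝓝 0) : ∃ 𝒜', IsEnvelope 𝔖 𝒜' ∧ 𝒜 ⊆ 𝒜' ∧
      StepIntegralsIn ℛ ν 𝒜' {z | ∃ y ∈ S, y - z ∈ T} := by
  have hP := hA.step.support_mem h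
  obtain ⟨ι, _, G, p, hG, hp⟩ := (hA.step.hasCells h hP).exists_decomposition h
    (fun x D G hGD hD y hy => hD y (hGD hy)) hP
  obtain ⟨F, hF⟩ := hA.step.exists_finset_forall_mem h hP hG hT
  have hstep : StepOn 𝔖 ν (fun x => ∑ i ∈ F, (G i : Set X).indicator (fun _ => s (p i)) x) _ :=
    StepOn.finset_sum F fun i _ => StepOn.indicator_const (G i).2 (s (p i))
  set U : Set X := ⋃ i ∈ F, (G i : Set X) with hU
  have hUℛ : U ∈ ℛ := h.isSetRing.biUnion_mem F fun i _ => h.mem (G i)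
  have hval : ∀ x, ∑ i ∈ F, (G i : Set X).indicator (fun _ => s (p i)) x = U.indicator s x := by
    intro x
    by_cases hx : x ∈ U
    · rw [indicator_of_mem hx]
      obtain ⟨i, hi, hxi⟩ := mem_iUnion₂.mp hx
      rw [Finset.sum_eq_single i, indicator_of_mem hxi, hp i x hxi]
      · exact fun j _ hj => indicator_of_notMem (fun hxj => (hG.1 hj).le_bot ⟨hxj, hxi⟩) _
      · exact fun hi' => (hi' hi).elim
    · rw [indicator_of_notMem hx]
      exact Finset.sum_eq_zero fun i hi =>
        indicator_of_notMem (fun hxi => hx (mem_iUnion₂.mpr ⟨i, hi, hxi⟩)) _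
  have hstep := hstep.congr hval fun R => rfl
  have hA' : RingEnvelope ℛ ν (𝒜 ∪ {0} ×ˢ Uᶜ) (U.indicator s) _ 𝔇 :=
    { step := hstep.mono h.subset
      approximates := fun x => by
        by_cases hx : x ∈ U
        · rw [indicator_of_mem hx]; exact Or.inl (hA.approximates x)
        · rw [indicator_of_notMem hx]; exact Or.inr ⟨rfl, hx⟩
      countable := hA.countable
      subset := hA.subset
      cell := by
        have hne' : ∀ x, U.indicator s x ≠ 0 → s x ≠ 0 := fun x => by
          by_cases hx : x ∈ U <;> simp [hx]
        rintro v x (hv | hv) hne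
        · obtain ⟨D, hD, hxD, hDv⟩ := hA.cell v x hv (hne.imp_right (hne' x))
          exact ⟨D, hD, hxD, fun y hy => Or.inl (hDv y hy)⟩
        · rcases hne with hne | hne
          · exact (hne hv.1).elim
          · exact (hne (indicator_of_notMem hv.2 s)).elim }
  refine ⟨_, hA'.isEnvelope h hstep, subset_union_left, fun u φ hu huA => ?_⟩
  -- Only on `B` can `u` have left `𝒜` by using the added zeros. Adding `s` there leads back into
  -- `𝒜` and changes the integral by `σ B`.
  set B : Set X := ({x | s x ≠ 0} \ U) \ {x | u x ≠ 0} with hB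
  have hBℛ : B ∈ ℛ := h.isSetRing.sdiff_mem (h.isSetRing.sdiff_mem hP hUℛ) (hu.support_mem h)
  have hT' := hF B hBℛ sdiff_subset
  refine ⟨_, hAS _ _ (hu.add (hA.step.indicator (A := B)
    fun D hD => h.isSetRing.inter_mem hD hBℛ)) fun x => ?_, ?_⟩
  · by_cases hx : x ∈ B
    · have : u x = 0 := by simpa using hx.2
      simpa [hx, this] using hA.approximates x
    · simp only [indicator_of_notMem hx, add_zero]
      rcases huA x with hux | ⟨hux, hxU⟩
      · exact hux
      · have hux : u x = 0 := hux
        have hsx : s x = 0 := by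
          by_contra hsx
          exact hx ⟨⟨hsx, hxU⟩, by simpa using hux⟩
        rw [hux, ← hsx]
        exact hA.approximates x
  · simpa using hT'

theorem hasIntegral_iff (h : IsRingExtension μ ℛ ν) :
    HasIntegral μ f a ↔ HasRingIntegral ℛ ν f a := by
  constructor
  · intro hf T hT
    obtain ⟨𝒜, hA, hfA, hAT⟩ := hf T hT
    obtain ⟨s, σ, 𝔇, hA', -⟩ := hA.exists_ringEnvelope h
    exact ⟨𝒜, s, σ, 𝔇, hA', hfA, fun u φ hu huA => hAT _ (hA.stepIntegralsIn h u φ hu huA)⟩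
  · intro hf T hT
    obtain ⟨T', hT', hclosed, hTT'⟩ := exists_mem_nhds_isClosed_subset hT
    obtain ⟨V, hV, hneg, h4⟩ := exists_symmetric_nhds hT'
    obtain ⟨𝒜, s, σ, 𝔇, hA, hfA, hAV⟩ := hf V hV
    obtain ⟨𝒜', hA', hsub, hAV'⟩ := hA.exists_isEnvelope h hAV hV
    refine ⟨𝒜', hA', fun x => hsub (hfA x), fun z hz => hTT' ?_⟩
    refine preIntegral_subset h (S := {z | z - a ∈ T'})
      (hclosed.preimage (continuous_sub_right a)) (fun u φ hu huA => ?_) hz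
    obtain ⟨y, hy, hyφ⟩ := hAV' u φ (hu.mono h.subset) huA
    have := h4 _ hy _ (hneg _ hyφ) 0 (mem_of_mem_nhds hV) 0 (mem_of_mem_nhds hV)
    simp only [mem_ofPred_eq]
    convert this using 1
    abel

theorem integrable_iff (h : IsRingExtension μ ℛ ν) :
    Integrable μ f ↔ ∃ a, HasRingIntegral ℛ ν f a :=
  exists_congr fun _ => hasIntegral_iff h

theorem HasRingIntegral.integral_eq (h : IsRingExtension μ ℛ ν) (hf : HasRingIntegral ℛ ν f a) :
    integral μ f = a := by
  have hi : Integrable μ f := (integrable_iff h).mpr ⟨a, hf⟩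
  rw [integral, dif_pos hi]
  exact ((hasIntegral_iff h).mp hi.choose_spec).unique h hf

theorem Integrable.hasRingIntegral (h : IsRingExtension μ ℛ ν) (hf : Integrable μ f) :
    HasRingIntegral ℛ ν f (integral μ f) := by
  obtain ⟨a, ha⟩ := (integrable_iff h).mp hf
  rwa [ha.integral_eq h]

end Transfer
-- Seminorm estimates for sums with bounded coefficients.
section Seminorms

variable {W : Type*} [AddCommGroup W] [Module ℝ W]

theorem exists_continuous_seminorm [TopologicalSpace W] [IsTopologicalAddGroup W]
    [ContinuousSMul ℝ W] [LocallyConvexSpace ℝ W] {T : Set W} (hT : T ∈ 𝓝 0) :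
    ∃ p : Seminorm ℝ W, Continuous p ∧ {x | p x < 1} ⊆ T := by
  obtain ⟨S, ⟨hS, hSo, hSc⟩, hST⟩ := (nhds_hasBasis_absConvex_open ℝ W).mem_iff.mp hT
  let S' : AbsConvexOpenSets ℝ W := ⟨S, hS, hSo, hSc⟩
  refine ⟨gaugeSeminormFamily ℝ W S', with_gaugeSeminormFamily.continuous_seminorm S', ?_⟩
  have := gaugeSeminormFamily_ball (𝕜 := ℝ) (E := W) S'
  rw [Seminorm.ball_zero_eq] at this
  rw [this]
  exact hST

theorem seminorm_sum_le {ι : Type*} (p : Seminorm ℝ W) (K : Finset ι) (z : ι → W) :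
    p (∑ i ∈ K, z i) ≤ ∑ i ∈ K, p (z i) :=
  Finset.le_sum_of_subadditive p (map_zero p).le (map_add_le_add p) K z

/-- A point of a cube is a convex combination of the vertices, and the vertices are the partial
sums. The offset `y` carries the induction over the coordinates. -/
theorem seminorm_add_sum_smul_le {ι : Type*} (p : Seminorm ℝ W) (K : Finset ι) {z : ι → W}
    {θ : ι → ℝ} (h0 : ∀ i, 0 ≤ θ i) (h1 : ∀ i, θ i ≤ 1) {c : ℝ} :
    ∀ y : W, (∀ K' ⊆ K, p (y + ∑ i ∈ K', z i) ≤ c) → p (y + ∑ i ∈ K, θ i • z i) ≤ c := by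
  classical
  induction K using Finset.induction_on with
  | empty => exact fun y hy => by simpa using hy ∅ subset_rfl
  | insert i K hi ih =>
    intro y hy
    have hA := ih y fun K' hK' => hy K' (hK'.trans (Finset.subset_insert i K))
    have hB := ih (y + z i) fun K' hK' => by
      have := hy (insert i K') (Finset.insert_subset_insert i hK')
      rwa [Finset.sum_insert (fun h => hi (hK' h)), ← add_assoc] at this
    have hdec : y + ∑ j ∈ insert i K, θ j • z j =
        (1 - θ i) • (y + ∑ j ∈ K, θ j • z j) + θ i • (y + z i + ∑ j ∈ K, θ j • z j) := by
      rw [Finset.sum_insert hi]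
      module
    rw [hdec]
    calc _ ≤ p ((1 - θ i) • (y + ∑ j ∈ K, θ j • z j)) + p (θ i • (y + z i + ∑ j ∈ K, θ j • z j)) :=
          map_add_le_add p _ _
      _ ≤ (1 - θ i) * c + θ i * c := by
          rw [map_smul_eq_mul, map_smul_eq_mul, Real.norm_of_nonneg (sub_nonneg.mpr (h1 i)),
            Real.norm_of_nonneg (h0 i)]
          exact add_le_add (mul_le_mul_of_nonneg_left hA (sub_nonneg.mpr (h1 i)))
            (mul_le_mul_of_nonneg_left hB (h0 i))
      _ = c := by ring

/-- Sums with coefficients in `[-1, 1]` are bounded by twice the bound for partial sums. -/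
theorem seminorm_sum_smul_le {ι : Type*} (p : Seminorm ℝ W) (K : Finset ι) {z : ι → W}
    {θ : ι → ℝ} (hθ : ∀ i, |θ i| ≤ 1) {c : ℝ} (hc : ∀ K' ⊆ K, p (∑ i ∈ K', z i) ≤ c) :
    p (∑ i ∈ K, θ i • z i) ≤ 2 * c := by
  have h1 := seminorm_add_sum_smul_le p K (z := z) (θ := fun i => (θ i)⁺)
    (fun i => posPart_nonneg _) (fun i => sup_le ((le_abs_self _).trans (hθ i)) zero_le_one) 0
    (fun K' hK' => by simpa using hc K' hK')
  have h2 := seminorm_add_sum_smul_le p K (z := z) (θ := fun i => (θ i)⁻)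
    (fun i => negPart_nonneg _) (fun i => sup_le ((neg_le_abs _).trans (hθ i)) zero_le_one) 0
    (fun K' hK' => by simpa using hc K' hK')
  rw [zero_add] at h1 h2
  have : ∑ i ∈ K, θ i • z i = ∑ i ∈ K, (θ i)⁺ • z i - ∑ i ∈ K, (θ i)⁻ • z i := by
    rw [← Finset.sum_sub_distrib]
    refine Finset.sum_congr rfl fun i _ => ?_
    rw [← sub_smul, posPart_sub_negPart]
  rw [this]
  refine (map_sub_le_add p _ _).trans ?_
  linarith

end Seminorms

/-! ### Membership in algebraic sums and semivariations. -/

section AlgebraicSums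

theorem sum_mem_algSum {Λ W : Type*} [AddCommGroup W] {S : Λ → Set W} (hS : ∀ l, 0 ∈ S l)
    (L : Finset Λ) {a : Λ → W} (ha : ∀ l ∈ L, a l ∈ S l) : ∑ l ∈ L, a l ∈ algSum S := by
  classical
  refine ⟨Finsupp.onFinset L (fun l => if l ∈ L then a l else 0) fun l hl => ?_, fun l => ?_, ?_⟩
  · by_contra h
    simp [h] at hl
  · by_cases h : l ∈ L
    · simpa [h] using ha l h
    · simpa [h] using hS l
  · rw [Finsupp.onFinset_sum _ fun _ => rfl]
    exact Finset.sum_congr rfl fun l hl => by simp [hl]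

variable {X W : Type*} [AddCommGroup W] [Module ℝ W] [TopologicalSpace W] {𝔖 : Set (Set X)}
  {μ : 𝔖 → W}

theorem sum_mem_svar (μ : 𝔖 → W) (f : X → ℝ) {ι : Type*} (K : Finset ι) {A : ι → 𝔖}
    (hA : Pairwise fun i j => Disjoint (A i : Set X) (A j : Set X)) :
    ∑ i ∈ K, integral μ ((A i : Set X).indicator f) ∈ svar μ f := by
  refine subset_closure ⟨K.card, fun j => A (K.equivFin.symm j), ?_, ?_⟩
  · intro i j hij
    exact hA fun h => hij (K.equivFin.symm.injective (Subtype.ext h))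
  · rw [← Finset.sum_coe_sort K]
    exact (Equiv.sum_comp K.equivFin.symm
      fun i : K => integral μ ((A i : Set X).indicator f)).symm

theorem zero_mem_svar (μ : 𝔖 → W) (f : X → ℝ) : 0 ∈ svar μ f :=
  subset_closure ⟨0, fun j => j.elim0, fun j => j.elim0, by simp⟩

end AlgebraicSums

/-! ### The Saks-Henstock lemma. -/

section SaksHenstock

variable {X W : Type*} [AddCommGroup W] [Module ℝ W] [UniformSpace W] [IsUniformAddGroup W]
  [ContinuousConstSMul ℝ W] [T2Space W] [CompleteSpace W]
  {𝔖 ℛ : Set (Set X)} {μ : 𝔖 → W} {ν : Set X → W} {𝒜 : Set (ℝ × X)}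
  {s : X → ℝ} {σ : Set X → W} {𝔇 : Set (Set X)} {f : X → ℝ} {a : W}

theorem HasRingIntegral.indicator (h : IsRingExtension μ ℛ ν) (hf : HasRingIntegral ℛ ν f a)
    (E : 𝔖) : HasRingIntegral ℛ ν ((E : Set X).indicator f)
      (integral μ ((E : Set X).indicator f)) := by
  obtain ⟨b, hb⟩ := hf.exists_indicator h (B := E) fun D hD => h.isSetRing.inter_mem hD (h.mem E)
  rwa [hb.integral_eq h]

/-- A version of the Saks-Henstock lemma. -/
theorem RingEnvelope.sum_sub_sum_mem (h : IsRingExtension μ ℛ ν)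
    (hA : RingEnvelope ℛ ν 𝒜 s σ 𝔇) (hfA : Approximates 𝒜 f) (hf : HasRingIntegral ℛ ν f a)
    {S : Set W} (hS : IsClosed S) (hAS : StepIntegralsIn ℛ ν 𝒜 {z | z - a ∈ S}) {ι : Type*}
    (K : Finset ι) {G : ι → 𝔖} (hG : Pairwise fun i j => Disjoint (G i : Set X) (G j : Set X))
    {v : ι → ℝ} (hv : ∀ i ∈ K, ∀ y ∈ (G i : Set X), (v i, y) ∈ 𝒜) :
    ∑ i ∈ K, v i • μ (G i) - ∑ i ∈ K, integral μ ((G i : Set X).indicator f) ∈ S := by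
  set A : Set X := ⋃ i ∈ K, (G i : Set X) with hAdef
  have hAℛ : A ∈ ℛ := h.isSetRing.biUnion_mem K fun i _ => h.mem (G i)
  have hAc : ∀ D ∈ ℛ, D ∩ Aᶜ ∈ ℛ := fun D hD => by
    rw [← sdiff_eq]; exact h.isSetRing.sdiff_mem hD hAℛ
  have hsum : ∀ (g : ι → X → ℝ) (x : X), (∀ i ∈ K, x ∈ (G i : Set X) →
      ∑ j ∈ K, (G j : Set X).indicator (g j) x = g i x) := by
    intro g x i hi hxi
    rw [Finset.sum_eq_single i, indicator_of_mem hxi]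
    · exact fun j _ hj => indicator_of_notMem (fun hxj => (hG hj).le_bot ⟨hxj, hxi⟩) _
    · exact fun hi' => (hi' hi).elim
  have hsum0 : ∀ (g : ι → X → ℝ) (x : X), x ∉ A → ∑ j ∈ K, (G j : Set X).indicator (g j) x = 0 :=
    fun g x hx => Finset.sum_eq_zero fun j hj =>
      indicator_of_notMem (fun hxj => hx (mem_iUnion₂.mpr ⟨j, hj, hxj⟩)) _
  obtain ⟨b, hb⟩ := hf.exists_indicator h hAc
  have hab : a = b + ∑ i ∈ K, integral μ ((G i : Set X).indicator f) := by
    refine hf.unique h ?_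
    convert hb.add h (HasRingIntegral.finset_sum h K fun i _ => hf.indicator h (G i)) using 2 with x
    by_cases hx : x ∈ A
    · obtain ⟨i, hi, hxi⟩ := mem_iUnion₂.mp hx
      rw [hsum (fun _ => f) x i hi hxi, indicator_of_notMem (by simpa using hx), zero_add]
    · rw [hsum0 (fun _ => f) x hx, indicator_of_mem (by simpa using hx), add_zero]
  -- Off `A` take a step function in `𝒜` with integral close to `b`, and on each `G i` the value `v
  -- i`. The glued function lies in `𝒜`, and subtracting `a = b + ∑ ∫ f χ` leaves the claimed
  -- difference up to `U`.
  rw [← hS.closure_eq, mem_closure_iff_nhds_zero]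
  intro U hU
  obtain ⟨u, φ, hu, huA, huU⟩ := (hA.restriction hAc).exists_step_sub_integral_mem h
    (hfA.restriction Aᶜ) hb hU
  have key := hAS _ _ ((StepOn.finset_sum K fun i _ =>
    StepOn.indicator_const (ν := ν) (h.mem (G i)) (v i)).add hu) fun x => by
      by_cases hx : x ∈ A
      · obtain ⟨i, hi, hxi⟩ := mem_iUnion₂.mp hx
        have hux : u x = 0 := (huA x).2 fun hx' => hx' hx
        rw [hsum (fun i _ => v i) x i hi hxi, hux, add_zero]
        exact hv i hi x hxi
      · have := (huA x).1 hx
        rwa [hsum0 (fun i _ => v i) x hx, zero_add]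
  refine ⟨_, key, ?_⟩
  convert huU using 1
  simp only [inter_univ, h.apply_mem]
  rw [hab]
  abel

end SaksHenstock
-- The envelope dominating a family.
section TailEnvelope

variable {X W Λ : Type*}

/-- The set of those `(v, x)` for which `|v|` is at most twice a finite sum of absolute values
of elements of the fibers of the `𝒜 l` at `x`. -/
def domination (𝒜 : Λ → Set (ℝ × X)) : Set (ℝ × X) :=
  {q | ∃ (Φ : Finset Λ) (w : Λ → ℝ), (∀ l ∈ Φ, (w l, q.2) ∈ 𝒜 l) ∧ |q.1| ≤ 2 * ∑ l ∈ Φ, |w l|}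

/-- The finite nonempty intersections of members of the families `𝔇 l`. -/
def finiteIntersections (𝔇 : Λ → Set (Set X)) : Set (Set X) :=
  (fun A => ⋂₀ A) '' {A | (A.Finite ∧ A ⊆ ⋃ l, 𝔇 l) ∧ A.Nonempty}

theorem countable_finiteIntersections [Countable Λ] {𝔇 : Λ → Set (Set X)}
    (h𝔇 : ∀ l, (𝔇 l).Countable) : (finiteIntersections 𝔇).Countable :=
  ((countable_ofPred_finite_subset (countable_iUnion h𝔇)).mono fun _ hA => hA.1).image _

theorem finiteIntersections_subset {ℛ : Set (Set X)} (hℛ : MeasureTheory.IsSetRing ℛ)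
    {𝔇 : Λ → Set (Set X)} (h𝔇 : ∀ l, 𝔇 l ⊆ ℛ) : finiteIntersections 𝔇 ⊆ ℛ := by
  rintro _ ⟨A, ⟨⟨hA, hA𝔇⟩, hne⟩, rfl⟩
  have hAℛ : A ⊆ ℛ := hA𝔇.trans (iUnion_subset h𝔇)
  have := hℛ.biInter_mem (s := id) hA.toFinset ((Finite.toFinset_nonempty hA).mpr hne)
    fun D hD => hAℛ (by simpa using hD)
  simpa [sInter_eq_biInter] using this

/-- The factor 2 in `domination` gives the room needed to pass from the infinite sum to a finite
one. If no finite sum sufficed, the series would converge absolutely with sum at most `|v| / 2`,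
although `|v| > 0`. At points of divergence every `v` is admitted. -/
theorem mem_domination_of_abs_le {𝒜 : Λ → Set (ℝ × X)} {F : Λ → X → ℝ}
    (hF : ∀ l, Approximates (𝒜 l) (F l)) {v : ℝ} {x : X}
    (hv : (Summable fun l => F l x) → |v| ≤ ∑' l, |F l x|) : (v, x) ∈ domination 𝒜 := by
  suffices ∃ Φ : Finset Λ, |v| ≤ 2 * ∑ l ∈ Φ, |F l x| by
    obtain ⟨Φ, hΦ⟩ := this
    exact ⟨Φ, fun l => F l x, fun l _ => hF l x, hΦ⟩
  by_contra! hlt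
  have hs : Summable fun l => |F l x| :=
    summable_of_sum_le (c := |v| / 2) (fun l => abs_nonneg _) fun Φ => by linarith [hlt Φ]
  have h1 : ∑' l, |F l x| ≤ |v| / 2 := by
    refine hs.tsum_le_of_sum_le fun Φ => by linarith [hlt Φ]
  have h2 := hv (summable_abs_iff.mp hs)
  have h3 := hlt ∅
  simp only [Finset.sum_empty, mul_zero] at h3
  linarith

variable [AddCommGroup W] [Module ℝ W] {𝔖 ℛ : Set (Set X)} {ν : Set X → W}

theorem exists_cell_of_mem_domination {𝒜 : Λ → Set (ℝ × X)} {s : Λ → X → ℝ}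
    {σ : Λ → Set X → W} {𝔇 : Λ → Set (Set X)} (hA : ∀ l, RingEnvelope ℛ ν (𝒜 l) (s l) (σ l) (𝔇 l))
    {v : ℝ} {x : X} (hv : (v, x) ∈ domination 𝒜) (hv0 : v ≠ 0) :
    ∃ D ∈ finiteIntersections 𝔇, x ∈ D ∧ ∃ (Φ : Finset Λ) (w : Λ → ℝ),
      (∀ l ∈ Φ, ∀ y ∈ D, (w l, y) ∈ 𝒜 l) ∧ |v| ≤ 2 * ∑ l ∈ Φ, |w l| := by
  classical
  obtain ⟨Φ, w, hw, hle⟩ := hv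
  have hcell : ∀ l, ∃ D, l ∈ Φ → w l ≠ 0 → D ∈ 𝔇 l ∧ x ∈ D ∧ ∀ y ∈ D, (w l, y) ∈ 𝒜 l := by
    intro l
    by_cases hl : l ∈ Φ ∧ w l ≠ 0
    · obtain ⟨D, hD⟩ := (hA l).cell _ x (hw l hl.1) (Or.inl hl.2)
      exact ⟨D, fun _ _ => hD⟩
    · exact ⟨∅, fun h1 h2 => (hl ⟨h1, h2⟩).elim⟩
  choose E hE using hcell
  -- Zero values may lack a cell and are discarded. As `v ≠ 0`, some index remains; the empty
  -- intersection would be `univ`, which need not be in `ℛ`.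
  have hsum : ∑ l ∈ Φ with w l ≠ 0, |w l| = ∑ l ∈ Φ, |w l| :=
    Finset.sum_filter_of_ne fun l _ hl => abs_ne_zero.mp hl
  have hne : (Φ.filter fun l => w l ≠ 0).Nonempty := by
    rw [Finset.nonempty_iff_ne_empty]
    intro h0
    rw [h0, Finset.sum_empty] at hsum
    rw [← hsum, mul_zero] at hle
    exact hv0 (abs_nonpos_iff.mp hle)
  refine ⟨⋂₀ (E '' ↑(Φ.filter fun l => w l ≠ 0)), ⟨_, ⟨⟨(Finset.finite_toSet _).image E, ?_⟩,
    (Finset.coe_nonempty.mpr hne).image E⟩, rfl⟩, ?_, Φ.filter fun l => w l ≠ 0, w, ?_, ?_⟩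
  · rintro _ ⟨l, hl, rfl⟩
    have hl := Finset.mem_filter.mp hl
    exact mem_iUnion.mpr ⟨l, (hE l hl.1 hl.2).1⟩
  · rintro _ ⟨l, hl, rfl⟩
    have hl := Finset.mem_filter.mp hl
    exact (hE l hl.1 hl.2).2.1
  · intro l hl y hy
    have hl' := Finset.mem_filter.mp hl
    exact (hE l hl'.1 hl'.2).2.2 y (hy _ ⟨l, hl, rfl⟩)
  · rwa [hsum]

theorem ringEnvelope_domination [Countable Λ] [TopologicalSpace W] {μ : 𝔖 → W}
    (h : IsRingExtension μ ℛ ν) {𝒜 : Λ → Set (ℝ × X)} {s : Λ → X → ℝ}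
    {σ : Λ → Set X → W} {𝔇 : Λ → Set (Set X)}
    (hA : ∀ l, RingEnvelope ℛ ν (𝒜 l) (s l) (σ l) (𝔇 l)) :
    RingEnvelope ℛ ν (domination 𝒜) (fun _ => 0) (fun _ => 0) (finiteIntersections 𝔇) where
  step := .zero
  approximates x := ⟨∅, 0, by simp, by simp⟩
  countable := countable_finiteIntersections fun l => (hA l).countable
  subset := finiteIntersections_subset h.isSetRing fun l => (hA l).subset
  cell v x hv hne := by
    obtain ⟨D, hD, hxD, Φ, w, hw, hle⟩ :=
      exists_cell_of_mem_domination hA hv (hne.elim id fun h => (h rfl).elim)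
    exact ⟨D, hD, hxD, fun y hy => ⟨Φ, w, fun l hl => hw l hl y hy, hle⟩⟩

end TailEnvelope

/-! ### Integrals of step functions in the dominating envelope. -/

section TailIntegral

variable {X W Λ : Type*} [AddCommGroup W] [Module ℝ W] [UniformSpace W] [IsUniformAddGroup W]
  [ContinuousSMul ℝ W] [T2Space W] [CompleteSpace W]
  {𝔖 ℛ : Set (Set X)} {μ : 𝔖 → W} {ν : Set X → W} {𝒜 : Λ → Set (ℝ × X)}
  {s : Λ → X → ℝ} {σ : Λ → Set X → W} {𝔇 : Λ → Set (Set X)} {F : Λ → X → ℝ}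

/-- For each `l` the Saks-Henstock lemma replaces the inner sum by an element of `svar μ (F l)` with
error `e l`. One `ε` bounds the errors, the other the sum of the semivariation elements. -/
theorem seminorm_sum_sum_le (h : IsRingExtension μ ℛ ν)
    (hA : ∀ l, RingEnvelope ℛ ν (𝒜 l) (s l) (σ l) (𝔇 l)) (hFA : ∀ l, Approximates (𝒜 l) (F l))
    (hF : ∀ l, Integrable μ (F l)) {p : Seminorm ℝ W} (hp : Continuous p) {ε : ℝ}
    (hsvar : ∀ z ∈ algSum (fun l => svar μ (F l)), p z ≤ ε) {e : Λ → ℝ}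
    (he : ∀ L : Finset Λ, ∑ l ∈ L, e l ≤ ε)
    (hAe : ∀ l, StepIntegralsIn ℛ ν (𝒜 l) {z | p (z - integral μ (F l)) ≤ e l})
    {ι : Type*} {G : ι → 𝔖} (hG : Pairwise fun i j => Disjoint (G i : Set X) (G j : Set X))
    (L : Finset Λ) (K : Λ → Finset ι) {w : ι → Λ → ℝ}
    (hw : ∀ l ∈ L, ∀ i ∈ K l, ∀ y ∈ (G i : Set X), (w i l, y) ∈ 𝒜 l) :
    p (∑ l ∈ L, ∑ i ∈ K l, w i l • μ (G i)) ≤ 2 * ε := by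
  have h1 : ∀ l ∈ L, p (∑ i ∈ K l, w i l • μ (G i) -
      ∑ i ∈ K l, integral μ ((G i : Set X).indicator (F l))) ≤ e l := fun l hl =>
    (hA l).sum_sub_sum_mem h (hFA l) ((hF l).hasRingIntegral h)
      (isClosed_le hp continuous_const : IsClosed {z | p z ≤ e l}) (hAe l) (K l) hG (hw l hl)
  have h2 := hsvar _ (sum_mem_algSum (fun l => zero_mem_svar μ (F l)) L
    fun l _ => sum_mem_svar μ (F l) (K l) hG)
  have h3 : ∑ l ∈ L, ∑ i ∈ K l, w i l • μ (G i) =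
      ∑ l ∈ L, (∑ i ∈ K l, w i l • μ (G i) -
        ∑ i ∈ K l, integral μ ((G i : Set X).indicator (F l))) +
      ∑ l ∈ L, ∑ i ∈ K l, integral μ ((G i : Set X).indicator (F l)) := by
    rw [← Finset.sum_add_distrib]
    simp
  rw [h3]
  calc _ ≤ _ := map_add_le_add p _ _
    _ ≤ ∑ l ∈ L, e l + ε := add_le_add ((seminorm_sum_le p L _).trans (Finset.sum_le_sum h1)) h2
    _ ≤ 2 * ε := by linarith [he L]

/-- The constant is `8 = 2 · 2 · 2`: the factor in `domination`, the passage to coefficients in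
`[-1, 1]`, and the bound `2 * ε` for partial sums. -/
theorem stepIntegralsIn_domination (h : IsRingExtension μ ℛ ν)
    (hA : ∀ l, RingEnvelope ℛ ν (𝒜 l) (s l) (σ l) (𝔇 l)) (hFA : ∀ l, Approximates (𝒜 l) (F l))
    (hF : ∀ l, Integrable μ (F l)) {p : Seminorm ℝ W} (hp : Continuous p) {ε : ℝ}
    (hsvar : ∀ z ∈ algSum (fun l => svar μ (F l)), p z ≤ ε) {e : Λ → ℝ}
    (he : ∀ L : Finset Λ, ∑ l ∈ L, e l ≤ ε)
    (hAe : ∀ l, StepIntegralsIn ℛ ν (𝒜 l) {z | p (z - integral μ (F l)) ≤ e l}) [Countable Λ] :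
    StepIntegralsIn ℛ ν (domination 𝒜) {z | p z ≤ 8 * ε} := by
  classical
  intro u φ hu huA
  have hQ := hu.support_mem h
  have hcells : HasCells ℛ {x | u x ≠ 0} fun x D => ∃ (Φ : Finset Λ) (w : Λ → ℝ),
      (∀ l ∈ Φ, ∀ y ∈ D, (w l, y) ∈ 𝒜 l) ∧ |u x| ≤ 2 * ∑ l ∈ Φ, |w l| :=
    ⟨finiteIntersections 𝔇, countable_finiteIntersections fun l => (hA l).countable,
      finiteIntersections_subset h.isSetRing fun l => (hA l).subset,
      fun x hx => exists_cell_of_mem_domination hA (huA x) hx⟩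
  have hanti : ∀ (x : X) (D G : Set X), G ⊆ D → (∃ (Φ : Finset Λ) (w : Λ → ℝ),
      (∀ l ∈ Φ, ∀ y ∈ D, (w l, y) ∈ 𝒜 l) ∧ |u x| ≤ 2 * ∑ l ∈ Φ, |w l|) →
      ∃ (Φ : Finset Λ) (w : Λ → ℝ),
      (∀ l ∈ Φ, ∀ y ∈ G, (w l, y) ∈ 𝒜 l) ∧ |u x| ≤ 2 * ∑ l ∈ Φ, |w l| :=
    fun x D G hGD ⟨Φ, w, hw, hle⟩ => ⟨Φ, w, fun l hl y hy => hw l hl y (hGD hy), hle⟩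
  obtain ⟨ι, _, G, q, hG, hq⟩ := (hcells.and h.isSetRing (hu.hasCells h hQ) hanti
    (fun x D G hGD hD y hy => hD y (hGD hy))).exists_decomposition h
    (fun x D G hGD hD => ⟨hanti x D G hGD hD.1, fun y hy => hD.2 y (hGD hy)⟩) hQ
  have hsum := hu.hasSum_decomposition h hQ
    (fun x hx => by_contra fun hx' => hx hx') hG (fun i => (hq i).2)
  refine (isClosed_le hp continuous_const).mem_of_tendsto hsum (Filter.Eventually.of_forall ?_)
  intro K
  choose Φ w hw hle using fun i => (hq i).1
  -- The ratio of `u` to its bound. If the denominator is zero then so is `u (q i)`, and the default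
  -- value `0` of the quotient is correct.
  let c : ι → ℝ := fun i => u (q i) / (2 * ∑ l ∈ Φ i, |w i l|)
  let θ : ι × Λ → ℝ := fun r => c r.1 * SignType.sign (w r.1 r.2)
  have hnn : ∀ i, 0 ≤ 2 * ∑ l ∈ Φ i, |w i l| := fun i =>
    mul_nonneg zero_le_two (Finset.sum_nonneg fun l _ => abs_nonneg _)
  have hc : ∀ i, |c i| ≤ 1 := fun i => by
    rw [abs_div, abs_of_nonneg (hnn i)]
    exact div_le_one_of_le₀ (hle i) (hnn i)
  have hθ : ∀ r, |θ r| ≤ 1 := fun r => by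
    rw [abs_mul]
    refine mul_le_one₀ (hc _) (abs_nonneg _) ?_
    rcases lt_trichotomy (w r.1 r.2) 0 with hlt | heq | hgt
    · simp [sign_neg hlt]
    · simp [heq]
    · simp [sign_pos hgt]
  have hu2 : ∀ i, u (q i) = 2 * ∑ l ∈ Φ i, θ (i, l) * w i l := by
    intro i
    have h1 : ∑ l ∈ Φ i, θ (i, l) * w i l = c i * ∑ l ∈ Φ i, |w i l| := by
      rw [Finset.mul_sum]
      refine Finset.sum_congr rfl fun l _ => ?_
      simp only [θ, mul_assoc, sign_mul_self]
    rw [h1]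
    rcases (hnn i).eq_or_lt with h0 | hpos
    · have hle' := hle i
      rw [← h0] at hle'
      rw [abs_nonpos_iff.mp hle']
      have : ∑ l ∈ Φ i, |w i l| = 0 := by linarith
      rw [this]; ring
    · have : ∑ l ∈ Φ i, |w i l| ≠ 0 := fun h0 => by rw [h0] at hpos; simp at hpos
      simp only [c]
      field_simp
  let R : Finset (ι × Λ) := K.biUnion fun i => (Φ i).image fun l => (i, l)
  have hR : ∀ r, r ∈ R ↔ r.1 ∈ K ∧ r.2 ∈ Φ r.1 := by
    rintro ⟨i, l⟩
    simp only [R, Finset.mem_biUnion, Finset.mem_image, Prod.mk.injEq]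
    constructor
    · rintro ⟨j, hj, m, hm, rfl, rfl⟩
      exact ⟨hj, hm⟩
    · rintro ⟨hi, hl⟩
      exact ⟨i, hi, l, hl, rfl, rfl⟩
  have hexp : ∑ i ∈ K, u (q i) • μ (G i) =
      (2 : ℝ) • ∑ r ∈ R, θ r • (w r.1 r.2 • μ (G r.1)) := by
    rw [Finset.sum_finset_product R K Φ hR, Finset.smul_sum]
    refine Finset.sum_congr rfl fun i _ => ?_
    rw [hu2 i, mul_smul, Finset.sum_smul]
    simp only [mul_smul]
  rw [mem_ofPred_eq, hexp, map_smul_eq_mul, Real.norm_of_nonneg zero_le_two]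
  have hbound := seminorm_sum_smul_le p R (z := fun r => w r.1 r.2 • μ (G r.1)) hθ (c := 2 * ε)
    fun K' hK' => by
      -- Group the pairs in `K'` by the index `l`: the set of pieces may depend on `l`, as
      -- `seminorm_sum_sum_le` permits.
      rw [Finset.sum_finset_product_right K' (K'.image Prod.snd)
        (fun l => (K'.filter fun r => r.2 = l).image Prod.fst) fun r => ?_]
      · refine seminorm_sum_sum_le h hA hFA hF hp hsvar he hAe hG.1 _ _ fun l _ i hi => ?_
        obtain ⟨⟨j, m⟩, hr, rfl⟩ := Finset.mem_image.mp hi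
        obtain ⟨hr', rfl⟩ := Finset.mem_filter.mp hr
        exact hw j m ((hR (j, m)).mp (hK' hr')).2
      · obtain ⟨i, l⟩ := r
        simp only [Finset.mem_image, Finset.mem_filter, Prod.exists]
        constructor
        · exact fun hr => ⟨⟨i, l, hr, rfl⟩, i, l, ⟨hr, rfl⟩, rfl⟩
        · rintro ⟨-, j, m, ⟨hr, rfl⟩, rfl⟩
          exact hr
  linarith

/-- A family of integrable functions whose semivariations have a small sum has an envelope with
small integrals which contains everything dominated by the sum of their absolute values. -/
theorem exists_dominating_envelope [Countable Λ] (h : IsRingExtension μ ℛ ν)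
    (hF : ∀ l, Integrable μ (F l)) {p : Seminorm ℝ W} (hp : Continuous p) {ε : ℝ} (hε : 0 < ε)
    (hsvar : ∀ z ∈ algSum (fun l => svar μ (F l)), p z ≤ ε) :
    ∃ 𝒞 𝔇, RingEnvelope ℛ ν 𝒞 (fun _ => 0) (fun _ => 0) 𝔇 ∧
      StepIntegralsIn ℛ ν 𝒞 {z | p z ≤ 8 * ε} ∧
      ∀ v x, ((Summable fun l => F l x) → |v| ≤ ∑' l, |F l x|) → (v, x) ∈ 𝒞 := by
  obtain ⟨e, hpos, he⟩ := (countable_univ (α := Λ)).exists_pos_forall_sum_le hε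
  have hT : ∀ l, {z | p z ≤ e l} ∈ 𝓝 (0 : W) := fun l =>
    hp.continuousAt.preimage_mem_nhds (by rw [map_zero]; exact Iic_mem_nhds (hpos l))
  choose 𝒜 s σ 𝔇 hA hFA hAe using fun l => (hF l).hasRingIntegral h _ (hT l)
  exact ⟨_, _, ringEnvelope_domination h hA, stepIntegralsIn_domination h hA hFA hF hp hsvar
    (fun L => he L (subset_univ _)) hAe, fun v x => mem_domination_of_abs_le hFA⟩

end TailIntegral
-- Tail estimates for real series.
section RealSeries

variable {Λ : Type*}

theorem abs_sum_le_tsum_compl {g : Λ → ℝ} (Ξ t : Finset Λ) (ht : Disjoint t Ξ)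
    (hg : Summable fun l : {l // l ∉ Ξ} => g l) :
    |∑ l ∈ t, g l| ≤ ∑' l : {l // l ∉ Ξ}, |g l| := by
  classical
  refine (Finset.abs_sum_le_sum_abs g t).trans ?_
  have : ∑ l ∈ t, |g l| = ∑ l ∈ t.subtype (· ∉ Ξ), |g l| :=
    (Finset.sum_subtype_of_mem (p := (· ∉ Ξ)) (fun l => |g l|)
      fun l hl => Finset.disjoint_left.mp ht hl).symm
  rw [this]
  exact hg.abs.sum_le_tsum _ fun l _ => abs_nonneg _

theorem summable_of_summable_compl {g : Λ → ℝ} (Ξ : Finset Λ)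
    (hg : Summable fun l : {l // l ∉ Ξ} => g l) : Summable g :=
  Ξ.summable_compl_iff.mp hg

theorem abs_tsum_sub_sum_le {g : Λ → ℝ} (hg : Summable g) {Ξ Ξ' : Finset Λ} (hΞ : Ξ ⊆ Ξ') :
    |∑' l, g l - ∑ l ∈ Ξ', g l| ≤ ∑' l : {l // l ∉ Ξ}, |g l| := by
  classical
  have hlim : Filter.Tendsto (fun t : Finset Λ => |∑ l ∈ t, g l - ∑ l ∈ Ξ', g l|) Filter.atTop
      (𝓝 |∑' l, g l - ∑ l ∈ Ξ', g l|) := (hg.hasSum.sub_const _).abs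
  refine le_of_tendsto hlim ?_
  filter_upwards [Filter.eventually_ge_atTop Ξ'] with t ht
  rw [← Finset.sum_sdiff_eq_sub ht]
  exact abs_sum_le_tsum_compl Ξ _ (Finset.sdiff_disjoint.mono_right hΞ)
    (hg.comp_injective Subtype.val_injective)

end RealSeries

/-! ### The Beppo Levi theorem for vector measures. -/

section BeppoLevi

variable {X W Λ : Type*} [AddCommGroup W] [Module ℝ W] [UniformSpace W] [IsUniformAddGroup W]
  [ContinuousSMul ℝ W] [LocallyConvexSpace ℝ W] [CompleteSpace W] [T2Space W]
  {𝔖 ℛ : Set (Set X)} {μ : 𝔖 → W} {ν : Set X → W} {F : Λ → X → ℝ} {f : X → ℝ}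

/-- The sums of the semivariations of the `F l` outside suitable finite sets are small. -/
def SmallTails (μ : 𝔖 → W) (F : Λ → X → ℝ) : Prop :=
  ∀ T ∈ 𝓝 (0 : W), ∃ Ξ : Finset Λ, algSum (fun l : {l : Λ // l ∉ Ξ} => svar μ (F l)) ⊆ T

/-- The common source of all conclusions. With `ε = 1 / 16` the step integrals satisfy `p z ≤ 1 /
2`, a closed condition inside the open unit ball of `p`. -/
theorem SmallTails.exists_envelope [Countable Λ] (h : IsRingExtension μ ℛ ν)
    (hF : ∀ l, Integrable μ (F l)) (hsmall : SmallTails μ F) {T : Set W} (hT : T ∈ 𝓝 0) :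
    ∃ (Ξ : Finset Λ) (𝒞 : Set (ℝ × X)) (𝔇 : Set (Set X)) (S : Set W), IsClosed S ∧ S ⊆ T ∧
      RingEnvelope ℛ ν 𝒞 (fun _ => 0) (fun _ => 0) 𝔇 ∧ StepIntegralsIn ℛ ν 𝒞 S ∧
      ∀ v x, ((Summable fun l => F l x) → |v| ≤ ∑' l : {l // l ∉ Ξ}, |F l x|) → (v, x) ∈ 𝒞 := by
  obtain ⟨p, hp, hpT⟩ := exists_continuous_seminorm hT
  have hU : {z | p z ≤ 1 / 16} ∈ 𝓝 (0 : W) :=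
    hp.continuousAt.preimage_mem_nhds (by rw [map_zero]; exact Iic_mem_nhds (show (0 : ℝ) < 1 / 16 by norm_num))
  obtain ⟨Ξ, hΞ⟩ := hsmall _ hU
  obtain ⟨𝒞, 𝔇, hC, hCS, hdom⟩ := exists_dominating_envelope h
    (F := fun l : {l // l ∉ Ξ} => F l) (fun l => hF l) hp (by norm_num) hΞ
  refine ⟨Ξ, 𝒞, 𝔇, _, isClosed_le hp continuous_const, fun z hz => hpT ?_, hC, hCS,
    fun v x hv => hdom v x fun hs => hv (summable_of_summable_compl Ξ hs)⟩
  have hz : p z ≤ 8 * (1 / 16) := hz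
  exact lt_of_le_of_lt hz (by norm_num)

theorem SmallTails.stronglyNegligible [Countable Λ] (h : IsRingExtension μ ℛ ν)
    (hF : ∀ l, Integrable μ (F l)) (hsmall : SmallTails μ F) :
    StronglyNegligible μ {x | ¬ Summable fun l => F l x} := by
  intro T hT
  obtain ⟨Ξ, 𝒞, 𝔇, S, hS, hST, hC, hCS, hdom⟩ := hsmall.exists_envelope h hF hT
  refine ⟨𝒞, ⟨hC.isEnvelope h .zero, hC.approximates⟩, ?_, (preIntegral_subset h hS
    fun u φ hu => hCS u φ (hu.mono h.subset)).trans hST⟩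
  rintro ⟨v, x⟩ ⟨-, hx⟩
  exact hdom v x fun hs => (hx hs).elim

theorem SmallTails.summable_integral [Countable Λ] (h : IsRingExtension μ ℛ ν)
    (hF : ∀ l, Integrable μ (F l)) (hsmall : SmallTails μ F) :
    Summable fun l => integral μ (F l) := by
  rw [summable_iff_vanishing]
  intro T hT
  obtain ⟨Ξ, 𝒞, 𝔇, S, hS, hST, hC, hCS, hdom⟩ := hsmall.exists_envelope h hF hT
  refine ⟨Ξ, fun t ht => hST ?_⟩
  refine hC.mem_of_isClosed h (fun x => hdom _ _ fun hs => ?_)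
    (HasRingIntegral.finset_sum h t fun l _ => (hF l).hasRingIntegral h) hS hCS
  exact abs_sum_le_tsum_compl Ξ t ht (hs.comp_injective Subtype.val_injective)

theorem SmallTails.hasRingIntegral [Countable Λ] (h : IsRingExtension μ ℛ ν)
    (hF : ∀ l, Integrable μ (F l)) (hsmall : SmallTails μ F)
    (hf : ∀ x, Summable (fun l => F l x) → f x = ∑' l, F l x) :
    HasRingIntegral ℛ ν f (∑' l, integral μ (F l)) := by
  refine hasRingIntegral_of_near h fun T hT => ?_
  obtain ⟨Ξ, 𝒞, 𝔇, S, hS, hST, hC, hCS, hdom⟩ := hsmall.exists_envelope h hF hT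
  have hlim : Filter.Tendsto (fun t : Finset Λ => ∑ l ∈ t, integral μ (F l) -
      ∑' l, integral μ (F l)) Filter.atTop (𝓝 0) := by
    have := (hsmall.summable_integral h hF).hasSum.sub_const (∑' l, integral μ (F l))
    rwa [sub_self] at this
  -- Enlarging `Ξ` makes the partial sum of integrals close to its limit, while the remainder of `f`
  -- stays dominated by the tail over the complement of `Ξ`.
  obtain ⟨Ξ', hΞ', hsub⟩ := ((hlim.eventually_mem hT).and
    (Filter.eventually_ge_atTop Ξ)).exists
  refine ⟨_, _, 𝒞, _, _, 𝔇, HasRingIntegral.finset_sum h Ξ' fun l _ => (hF l).hasRingIntegral h,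
    hΞ', hC, fun x => hdom _ _ fun hs => ?_, fun u φ hu huC => hST (hCS u φ hu huC)⟩
  beta_reduce
  rw [hf x hs]
  exact abs_tsum_sub_sum_le hs hsub

theorem SmallTails.svar_subset [Countable Λ] (h : IsRingExtension μ ℛ ν)
    (hF : ∀ l, Integrable μ (F l)) (hsmall : SmallTails μ F)
    (hf : ∀ x, Summable (fun l => F l x) → f x = ∑' l, F l x) :
    svar μ f ⊆ closure (algSum fun l => svar μ (F l)) := by
  refine closure_minimal ?_ isClosed_closure
  rintro z ⟨n, A, hA, rfl⟩
  rw [mem_closure_iff_nhds_zero]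
  intro T hT
  obtain ⟨Ξ, 𝒞, 𝔇, S, hS, hST, hC, hCS, hdom⟩ :=
    -- The closure criterion asks for approximant minus `z`, whereas the envelope controls `z` minus
    -- approximant; hence the reflected neighborhood.
    hsmall.exists_envelope h hF (neg_mem_nhds_zero W hT)
  refine ⟨∑ l ∈ Ξ, ∑ j, integral μ ((A j : Set X).indicator (F l)),
    sum_mem_algSum (fun l => zero_mem_svar μ (F l)) Ξ
      fun l _ => sum_mem_svar μ (F l) Finset.univ hA, ?_⟩
  have hint := (HasRingIntegral.finset_sum h Finset.univ fun j _ =>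
    (hsmall.hasRingIntegral h hF hf).indicator h (A j)).sub h
    (HasRingIntegral.finset_sum h Ξ fun l _ => HasRingIntegral.finset_sum h Finset.univ fun j _ =>
      ((hF l).hasRingIntegral h).indicator h (A j))
  have := hST (hC.mem_of_isClosed h (fun x => ?_) hint hS hCS)
  · simpa using this
  by_cases hx : ∃ j, x ∈ (A j : Set X)
  · obtain ⟨j, hxj⟩ := hx
    have key : ∀ g : X → ℝ, ∑ i, (A i : Set X).indicator g x = g x := fun g => by
      rw [Finset.sum_eq_single j, indicator_of_mem hxj]
      · exact fun i _ hi => indicator_of_notMem (fun hxi => (hA hi).le_bot ⟨hxi, hxj⟩) _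
      · exact fun hj => (hj (Finset.mem_univ j)).elim
    simp only [key]
    refine hdom _ _ fun hs => ?_
    rw [hf x hs]
    exact abs_tsum_sub_sum_le hs subset_rfl
  · push Not at hx
    have key : ∀ g : X → ℝ, ∑ i, (A i : Set X).indicator g x = 0 := fun g =>
      Finset.sum_eq_zero fun i _ => indicator_of_notMem (hx i) _
    simp only [key, Finset.sum_const_zero, sub_self]
    exact hC.approximates x

theorem beppoLevi [Countable Λ] (h𝔖 : IsIntervalSystem 𝔖) (hμ : IsMeasure μ)
    (hF : ∀ l, Integrable μ (F l)) (hsmall : SmallTails μ F) :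
    StronglyNegligible μ {x | ¬ Summable fun l => F l x} ∧
      ∀ f : X → ℝ, (∀ x, Summable (fun l => F l x) → f x = ∑' l, F l x) →
        Integrable μ f ∧ HasSum (fun l => integral μ (F l)) (integral μ f) ∧
        svar μ f ⊆ closure (algSum fun l => svar μ (F l)) := by
  have h := hμ.isRingExtension h𝔖
  refine ⟨hsmall.stronglyNegligible h hF, fun f hf => ?_⟩
  have hint := hsmall.hasRingIntegral h hF hf
  refine ⟨(integrable_iff h).mpr ⟨_, hint⟩, ?_, hsmall.svar_subset h hF hf⟩
  rw [hint.integral_eq h]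
  exact (hsmall.summable_integral h hF).hasSum

end BeppoLevi

/-! ### Bounded sums of semivariations for real measures. -/

section RealMeasures

variable {X Λ : Type*} {𝔖 : Set (Set X)} {μ : 𝔖 → ℝ} {F : Λ → X → ℝ}

/-- Choices from sets containing `0` with bounded algebraic sum are uniformly summable. -/
theorem exists_finset_abs_sum_le {S : Λ → Set ℝ} (h0 : ∀ l, 0 ∈ S l)
    (hclosed : ∀ l, IsClosed (S l)) (hS : Bornology.IsBounded (algSum S)) {ε : ℝ} (hε : 0 < ε) :
    ∃ Ξ : Finset Λ, ∀ L : Finset Λ, Disjoint L Ξ → ∀ a : Λ → ℝ, (∀ l ∈ L, a l ∈ S l) →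
      |∑ l ∈ L, a l| < ε := by
  classical
  obtain ⟨M, hM⟩ := hS.exists_norm_le
  have hbd : ∀ l, ∀ x ∈ S l, |x| ≤ M := fun l x hx => by
    simpa using hM _ (sum_mem_algSum h0 {l} (a := fun _ => x)
      fun l' hl' => by rwa [Finset.mem_singleton.mp hl'])
  have habove : ∀ l, BddAbove (S l) := fun l => ⟨M, fun x hx => (abs_le.mp (hbd l x hx)).2⟩
  have hbelow : ∀ l, BddBelow (S l) := fun l => ⟨-M, fun x hx => (abs_le.mp (hbd l x hx)).1⟩
  -- Closed bounded sets contain their suprema and infima, so finite sums of these belong to `algSum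
  -- S` and are bounded by `M`.
  have hs : Summable fun l => sSup (S l) :=
    summable_of_sum_le (fun l => le_csSup (habove l) (h0 l)) fun L =>
      (abs_le.mp (hM _ (sum_mem_algSum h0 L
        fun l _ => (hclosed l).csSup_mem ⟨0, h0 l⟩ (habove l)))).2
  have hi : Summable fun l => -sInf (S l) :=
    summable_of_sum_le (c := M) (fun l => neg_nonneg.mpr (csInf_le (hbelow l) (h0 l))) fun L => by
      have := (abs_le.mp (hM _ (sum_mem_algSum h0 L
        fun l _ => (hclosed l).csInf_mem ⟨0, h0 l⟩ (hbelow l)))).1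
      rw [Finset.sum_neg_distrib]
      linarith
  obtain ⟨Ξ₁, h1⟩ := summable_iff_vanishing.mp hs _ (Iio_mem_nhds hε)
  obtain ⟨Ξ₂, h2⟩ := summable_iff_vanishing.mp hi _ (Iio_mem_nhds hε)
  refine ⟨Ξ₁ ∪ Ξ₂, fun L hL a ha => abs_lt.mpr ⟨?_, ?_⟩⟩
  · have h3 : ∑ l ∈ L, -sInf (S l) < ε := h2 L (hL.mono_right Finset.subset_union_right)
    have h4 : ∑ l ∈ L, sInf (S l) ≤ ∑ l ∈ L, a l :=
      Finset.sum_le_sum fun l hl => csInf_le (hbelow l) (ha l hl)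
    rw [Finset.sum_neg_distrib] at h3
    linarith
  · have h3 : ∑ l ∈ L, sSup (S l) < ε := h1 L (hL.mono_right Finset.subset_union_left)
    have h4 : ∑ l ∈ L, a l ≤ ∑ l ∈ L, sSup (S l) :=
      Finset.sum_le_sum fun l hl => le_csSup (habove l) (ha l hl)
    linarith

theorem smallTails_of_isBounded
    (hF : Bornology.IsBounded (algSum fun l => svar μ (F l))) : SmallTails μ F := by
  intro T hT
  obtain ⟨ε, hε, hεT⟩ := Metric.mem_nhds_iff.mp hT
  obtain ⟨Ξ, hΞ⟩ := exists_finset_abs_sum_le (fun l => zero_mem_svar μ (F l))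
    (fun l => isClosed_closure) hF hε
  refine ⟨Ξ, ?_⟩
  rintro _ ⟨a, ha, rfl⟩
  refine hεT ?_
  -- Regard the family on the complement of `Ξ` as a family on `Λ`, extended by zero.
  have := hΞ (a.support.map (Function.Embedding.subtype _))
    (Finset.disjoint_left.mpr fun l hl => by
      obtain ⟨⟨l', hl'⟩, -, rfl⟩ := Finset.mem_map.mp hl
      exact hl') (Function.extend Subtype.val a 0) (fun l hl => by
      obtain ⟨l', -, rfl⟩ := Finset.mem_map.mp hl
      rw [Function.Embedding.subtype_apply, Subtype.val_injective.extend_apply]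
      exact ha l')
  rw [Finset.sum_map] at this
  simp only [Function.Embedding.subtype_apply, Subtype.val_injective.extend_apply] at this
  simpa [Finsupp.sum] using this

end RealMeasures

end LebesgueMcShane

theorem mainTheorem6 {X : Type*} (𝔖 : Set (Set X))
    (h𝔖 : LebesgueMcShane.IsIntervalSystem 𝔖)
    {W : Type*} [AddCommGroup W] [Module ℝ W] [UniformSpace W] [IsUniformAddGroup W]
    [ContinuousSMul ℝ W] [LocallyConvexSpace ℝ W] [CompleteSpace W] [T2Space W] :
    -- measures with values in a locally convex space
    (∀ μ : 𝔖 → W, LebesgueMcShane.IsMeasure μ →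
      ∀ (Λ : Type*) [Countable Λ] (F : Λ → X → ℝ),
      (∀ l, LebesgueMcShane.Integrable μ (F l)) →
      (∀ T ∈ 𝓝 (0 : W), ∃ Ξ : Finset Λ,
        LebesgueMcShane.algSum
          (fun l : {l : Λ // l ∉ Ξ} => LebesgueMcShane.svar μ (F l)) ⊆ T) →
      LebesgueMcShane.StronglyNegligible μ {x | ¬ Summable fun l => F l x} ∧
      ∀ f : X → ℝ, (∀ x, Summable (fun l => F l x) → f x = ∑' l, F l x) →
        LebesgueMcShane.Integrable μ f ∧
        HasSum (fun l => LebesgueMcShane.integral μ (F l)) (LebesgueMcShane.integral μ f) ∧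
        LebesgueMcShane.svar μ f ⊆
          closure (LebesgueMcShane.algSum fun l => LebesgueMcShane.svar μ (F l))) ∧
    -- the reformulation for real-valued measures
    (∀ μ : 𝔖 → ℝ, LebesgueMcShane.IsMeasure μ →
      ∀ F : ℕ → X → ℝ,
      (∀ n, LebesgueMcShane.Integrable μ (F n)) →
      Bornology.IsBounded
        (LebesgueMcShane.algSum fun n => LebesgueMcShane.svar μ (F n)) →
      LebesgueMcShane.StronglyNegligible μ {x | ¬ Summable fun n => F n x} ∧
      ∀ f : X → ℝ, (∀ x, Summable (fun n => F n x) → f x = ∑' n, F n x) →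
        LebesgueMcShane.Integrable μ f ∧
        HasSum (fun n => LebesgueMcShane.integral μ (F n)) (LebesgueMcShane.integral μ f) ∧
        LebesgueMcShane.svar μ f ⊆
          closure (LebesgueMcShane.algSum fun n => LebesgueMcShane.svar μ (F n))) := by
  refine ⟨fun μ hμ Λ _ F hF hsmall => LebesgueMcShane.beppoLevi h𝔖 hμ hF hsmall,
    fun μ hμ F hF hbdd => LebesgueMcShane.beppoLevi h𝔖 hμ hF
      (LebesgueMcShane.smallTails_of_isBounded hbdd)⟩
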